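/- Let $M$ be a connected smooth manifold with a smooth pseudo-Riemannian metric $T_2$ (nondegenerate, of any signature), and let $F_2$ be an electromagnetic field on $M$, i.e. a smooth closed $2$-form. For a vector field $u$ write $\|u\|^2=T_2(u,u)$; $\operatorname{grad}$ of a $1$-form or of a function is taken with respect to $T_2$, $\Delta f=\operatorname{div}\operatorname{grad} f$ (extended $\mathbb C$-linearly to complex functions), and $\delta$ is the codifferential, $(\delta F_2)_k=-\nabla^iF_{ik}$. On $TM$ let $\theta_v=i_vT_2$ be the Liouville form, $T(v)=\tfrac12T_2(v,v)$ the kinetic energy and $\omega_F=d\theta+F_2$ ($F_2$ pulled back to $TM$). The Lorentz field is the second order differential equation $D$ on $M$ (a vector field on $TM$ with $\pi_*D_v=v$) such that $i_D\omega_F+dT=0$. A vector field $u$ on $M$ is an intermediate integral of $D$ if $D$ is tangent to the section $u:M\to TM$; it is $\omega_F$-Lagrangian if $u^*\omega_F=0$. A vector potential of $F_2$ on an open set $U$ is a smooth vector field $A$ on $U$ with $d(i_AT_2)=F_2$. Suppose that the Maxwell current $J=\operatorname{grad}\delta F_2$ is an intermediate integral of the Lorentz field and is $\omega_F$-Lagrangian.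 Then: 1) $-J$ is a vector potential of $F_2$ on $M$. 2) $\|J\|$ is a constant $\pm m$: there is $m\in\mathbb C$ (real or purely imaginary) with $T_2(J,J)=m^2$ on all of $M$. 3) Let $A$ be a vector potential of $F_2$ on an open set $U\subseteq M$. Every point of $U$ has an open neighbourhood $V\subseteq U$ with a smooth function $S:V\to\mathbb R$ such that $J+A=\operatorname{grad}S$ on $V$. If moreover $A$ satisfies the Lorentz gauge condition $\operatorname{div}A=0$ on $U$, and $S$ is a smooth real function on $U$ with $J+A=\operatorname{grad}S$, then $\Psi=e^{iS}$ satisfies on $U$ the Klein–Gordon equation $$\left(\Delta-2i\,A-\|A\|^2+m^2\right)\Psi=0,$$ where $A$ acts on functions as a derivation. -/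

import Mathlib

open Set Bundle Manifold
open scoped ContDiff Manifold

attribute [-instance] TopCat.of.chartedSpace TopCat.of.hasGroupoid

noncomputable section

/-! ### Differential forms on a manifold -/

section Forms

variable {E : Type*} [NormedAddCommGroup E] [NormedSpace ℝ E]
  {H : Type*} [TopologicalSpace H] (I : ModelWithCorners ℝ E H)
  (N : Type*) [TopologicalSpace N] [ChartedSpace H N]

/-- (Not necessarily smooth) differential forms of degree `k` on the manifold `N`. -/
abbrev DiffForm (k : ℕ) := (x : N) → TangentSpace I x [⋀^Fin k]→L[ℝ] ℝ

variable {I N} {k : ℕ}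

/-- The expression of a form in the chart at `x₀`: its pull-back by the inverse of that chart. -/
def DiffForm.inChart (η : DiffForm I N k) (x₀ : N) (y : E) : E [⋀^Fin k]→L[ℝ] ℝ :=
  (η ((extChartAt I x₀).symm y)).compContinuousLinearMap
    (mfderivWithin 𝓘(ℝ, E) I (extChartAt I x₀).symm (range I) y)

/-- A form is smooth if its expression in charts is smooth. -/
def DiffForm.IsSmooth (η : DiffForm I N k) : Prop :=
  ∀ x₀ : N, ContDiffOn ℝ ∞ (η.inChart x₀) (extChartAt I x₀).target

/-- The exterior derivative of a form: at the point `x` it is computed in the chart at `x`.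
The normalization is `dη(X, Y) = X(η(Y)) - Y(η(X)) - η([X, Y])` on 1-forms. -/
def DiffForm.d (η : DiffForm I N k) : DiffForm I N (k + 1) := fun x ↦
  (extDerivWithin (η.inChart x) (range I) (extChartAt I x x)).compContinuousLinearMap
    (mfderiv I 𝓘(ℝ, E) (extChartAt I x) x)

/-- A field of covectors, regarded as a differential form of degree one. -/
def DiffForm.ofCovector (α : (x : N) → TangentSpace I x →L[ℝ] ℝ) : DiffForm I N 1 := fun x ↦
  ContinuousAlternatingMap.ofSubsingleton ℝ (TangentSpace I x) ℝ (0 : Fin 1) (α x)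

end Forms

/-! ### Pseudo-Riemannian metrics -/

/-- A smooth pseudo-Riemannian (nondegenerate, of any signature) metric on an `n`-manifold. -/
structure PseudoRiemMetric (n : ℕ) (M : Type*) [TopologicalSpace M]
    [ChartedSpace (EuclideanSpace ℝ (Fin n)) M] [IsManifold (𝓡 n) ∞ M] where
  /-- The scalar product of each tangent space. -/
  val (x : M) : TangentSpace (𝓡 n) x →L[ℝ] TangentSpace (𝓡 n) x →L[ℝ] ℝ
  symm (x : M) (v w : TangentSpace (𝓡 n) x) : val x v w = val x w v
  nondegenerate (x : M) (v : TangentSpace (𝓡 n) x) (hv : ∀ w, val x v w = 0) : v = 0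
  contMDiff : ContMDiff (𝓡 n)
    ((𝓡 n).prod 𝓘(ℝ, EuclideanSpace ℝ (Fin n) →L[ℝ] EuclideanSpace ℝ (Fin n) →L[ℝ] ℝ)) ∞
    (fun x ↦ TotalSpace.mk' (EuclideanSpace ℝ (Fin n) →L[ℝ] EuclideanSpace ℝ (Fin n) →L[ℝ] ℝ)
      (E := fun x : M ↦ TangentSpace (𝓡 n) x →L[ℝ] TangentSpace (𝓡 n) x →L[ℝ] ℝ) x (val x))

namespace PseudoRiemMetric

variable {n : ℕ} {M : Type*} [TopologicalSpace M] [ChartedSpace (EuclideanSpace ℝ (Fin n)) M]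
  [IsManifold (𝓡 n) ∞ M] (g : PseudoRiemMetric n M)

/-- The 1-form `i_u g` attached by the metric to a vector field `u`. -/
def flat (u : (x : M) → TangentSpace (𝓡 n) x) : DiffForm (𝓡 n) M 1 :=
  DiffForm.ofCovector fun x ↦ g.val x (u x)

theorem exists_val_eq (x : M) (α : TangentSpace (𝓡 n) x →L[ℝ] ℝ) : ∃ v, g.val x v = α := by
  have : FiniteDimensional ℝ (TangentSpace (𝓡 n) x) :=
    inferInstanceAs (FiniteDimensional ℝ (EuclideanSpace ℝ (Fin n)))
  let L : TangentSpace (𝓡 n) x →ₗ[ℝ] Module.Dual ℝ (TangentSpace (𝓡 n) x) :=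
    { toFun := fun v ↦ (g.val x v).toLinearMap
      map_add' := fun v w ↦ by ext; simp
      map_smul' := fun c v ↦ by ext; simp }
  have hinj : Function.Injective L := by
    rw [← LinearMap.ker_eq_bot, LinearMap.ker_eq_bot']
    intro v hv
    exact g.nondegenerate x v fun w ↦ LinearMap.congr_fun hv w
  obtain ⟨v, hv⟩ := (LinearMap.injective_iff_surjective_of_finrank_eq_finrank
    (Subspace.dual_finrank_eq (K := ℝ) (V := TangentSpace (𝓡 n) x)).symm).1 hinj α.toLinearMap
  exact ⟨v, ContinuousLinearMap.coe_injective hv⟩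

/-- The gradient of a covector: the vector `v` with `i_v g = α`. -/
def sharp (x : M) (α : TangentSpace (𝓡 n) x →L[ℝ] ℝ) : TangentSpace (𝓡 n) x :=
  (g.exists_val_eq x α).choose

theorem val_sharp (x : M) (α : TangentSpace (𝓡 n) x →L[ℝ] ℝ) : g.val x (g.sharp x α) = α :=
  (g.exists_val_eq x α).choose_spec

/-- The gradient of a function. -/
def grad (f : M → ℝ) (x : M) : TangentSpace (𝓡 n) x :=
  g.sharp x (mfderiv (𝓡 n) 𝓘(ℝ, ℝ) f x)

/-! ### Coordinate expressions, divergence, codifferential, Laplacian -/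

/-- The coordinate field `∂ᵢ` of the chart at `x₀`, at the point of coordinates `y`. -/
def coordField (x₀ : M) (y : EuclideanSpace ℝ (Fin n)) (i : Fin n) :
    TangentSpace (𝓡 n) ((extChartAt (𝓡 n) x₀).symm y) :=
  mfderivWithin 𝓘(ℝ, EuclideanSpace ℝ (Fin n)) (𝓡 n) (extChartAt (𝓡 n) x₀).symm (range (𝓡 n)) y
    (EuclideanSpace.single i (1 : ℝ))

/-- The components `gᵢⱼ` of the metric in the chart at `x₀`. -/
def gram (x₀ : M) (y : EuclideanSpace ℝ (Fin n)) : Matrix (Fin n) (Fin n) ℝ :=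
  Matrix.of fun i j ↦
    g.val ((extChartAt (𝓡 n) x₀).symm y) (coordField x₀ y i) (coordField x₀ y j)

/-- The Riemannian density `√|det gᵢⱼ|` in the chart at `x₀`. -/
def density (x₀ : M) (y : EuclideanSpace ℝ (Fin n)) : ℝ :=
  √|(g.gram x₀ y).det|

/-- The components `Xⁱ` of a vector field in the chart at `x₀`. -/
def vecCoord (X : (x : M) → TangentSpace (𝓡 n) x) (x₀ : M) (y : EuclideanSpace ℝ (Fin n)) :
    EuclideanSpace ℝ (Fin n) :=
  mfderiv (𝓡 n) 𝓘(ℝ, EuclideanSpace ℝ (Fin n)) (extChartAt (𝓡 n) x₀)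
    ((extChartAt (𝓡 n) x₀).symm y) (X ((extChartAt (𝓡 n) x₀).symm y))

/-- The divergence `div X = |g|^(-1/2) ∂ᵢ(|g|^(1/2) Xⁱ)` of a vector field. -/
def divergence (X : (x : M) → TangentSpace (𝓡 n) x) (x : M) : ℝ :=
  (g.density x (extChartAt (𝓡 n) x x))⁻¹ *
    ∑ i, fderiv ℝ (fun y ↦ g.density x y * vecCoord X x y i) (extChartAt (𝓡 n) x x)
      (EuclideanSpace.single i (1 : ℝ))

/-- The Laplacian `Δf = div grad f` of a real function. -/
def laplacian (f : M → ℝ) (x : M) : ℝ :=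
  g.divergence (g.grad f) x

/-- The Laplacian of a complex function (extension of `laplacian` by `ℂ`-linearity). -/
def laplacianC (Ψ : M → ℂ) (x : M) : ℂ :=
  (g.laplacian (fun y ↦ (Ψ y).re) x : ℂ) + Complex.I * (g.laplacian (fun y ↦ (Ψ y).im) x : ℂ)

/-- The contravariant components `Fⁱʲ = gⁱᵃ gʲᵇ F(∂ₐ, ∂_b)` of a 2-form in the chart at `x₀`. -/
def raised (F : DiffForm (𝓡 n) M 2) (x₀ : M) (y : EuclideanSpace ℝ (Fin n)) :
    Matrix (Fin n) (Fin n) ℝ :=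
  (g.gram x₀ y)⁻¹ *
    (Matrix.of fun a b ↦
      F ((extChartAt (𝓡 n) x₀).symm y) ![coordField x₀ y a, coordField x₀ y b]) *
    ((g.gram x₀ y)⁻¹).transpose

/-- The components `-∇ᵢ Fⁱʲ = -|g|^(-1/2) ∂ᵢ(|g|^(1/2) Fⁱʲ)`, at `x`, in the chart at `x`. -/
def codiffCoord (F : DiffForm (𝓡 n) M 2) (x : M) (j : Fin n) : ℝ :=
  -((g.density x (extChartAt (𝓡 n) x x))⁻¹ *
    ∑ i, fderiv ℝ (fun y ↦ g.density x y * g.raised F x y i j) (extChartAt (𝓡 n) x x)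
      (EuclideanSpace.single i (1 : ℝ)))

/-- The codifferential `δF`, `(δF)ₖ = -gₖⱼ ∇ᵢ Fⁱʲ`, of a 2-form: the formal adjoint of `d` for the
scalar product of forms defined by the metric. -/
def codiff (F : DiffForm (𝓡 n) M 2) (x : M) : TangentSpace (𝓡 n) x →L[ℝ] ℝ :=
  ∑ k, ∑ j, (g.gram x (extChartAt (𝓡 n) x x) k j * g.codiffCoord F x j) •
    (EuclideanSpace.proj k : EuclideanSpace ℝ (Fin n) →L[ℝ] ℝ).comp
      (mfderiv (𝓡 n) 𝓘(ℝ, EuclideanSpace ℝ (Fin n)) (extChartAt (𝓡 n) x) x)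

/-! ### Mechanics on the tangent bundle -/

/-- The kinetic energy `T` on the tangent bundle. -/
def kinetic (p : TangentBundle (𝓡 n) M) : ℝ := g.val p.proj p.snd p.snd / 2

/-- The differential `dT` of the kinetic energy. -/
def dkinetic (p : TangentBundle (𝓡 n) M) : TangentSpace (𝓡 n).tangent p →L[ℝ] ℝ :=
  mfderiv (𝓡 n).tangent 𝓘(ℝ, ℝ) g.kinetic p

/-- The tangent map of the projection `TM → M`. -/
def dproj (p : TangentBundle (𝓡 n) M) :
    TangentSpace (𝓡 n).tangent p →L[ℝ] TangentSpace (𝓡 n) p.proj :=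
  mfderiv (𝓡 n).tangent (𝓡 n) (fun q : TangentBundle (𝓡 n) M ↦ q.proj) p

/-- The Liouville form of the cotangent bundle, transported to `TM` by the metric. -/
def liouville : DiffForm (𝓡 n).tangent (TangentBundle (𝓡 n) M) 1 :=
  DiffForm.ofCovector fun p ↦ (g.val p.proj p.snd).comp (dproj p)

/-- The form `ω_F = dθ + F` on `TM` (`F` being lifted to `TM` by pull-back). -/
def omegaF (F : DiffForm (𝓡 n) M 2) :
    DiffForm (𝓡 n).tangent (TangentBundle (𝓡 n) M) 2 := fun p ↦
  g.liouville.d p + (F p.proj).compContinuousLinearMap (dproj p)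

/-- `D` is the Lorentz field of `F`: the second order differential equation on `M` that satisfies
Newton's equation `i_D ω_F + dT = 0`, that is, the equation of motion of the mechanical system
with force form `i_ḋ F`. -/
structure IsLorentzField (F : DiffForm (𝓡 n) M 2)
    (D : (p : TangentBundle (𝓡 n) M) → TangentSpace (𝓡 n).tangent p) : Prop where
  secondOrder (p : TangentBundle (𝓡 n) M) : dproj p (D p) = p.snd
  newton (p : TangentBundle (𝓡 n) M) (W : TangentSpace (𝓡 n).tangent p) :
    g.omegaF F p ![D p, W] + g.dkinetic p W = 0

/-- A vector field on `M` as a section `M → TM`. -/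
def sectionMap (u : (x : M) → TangentSpace (𝓡 n) x) (x : M) : TangentBundle (𝓡 n) M := ⟨x, u x⟩

/-- The tangent map of the section `u : M → TM`. -/
def dsection (u : (x : M) → TangentSpace (𝓡 n) x) (x : M) :
    TangentSpace (𝓡 n) x →L[ℝ] TangentSpace (𝓡 n).tangent (sectionMap u x) :=
  mfderiv (𝓡 n) (𝓡 n).tangent (sectionMap u) x

/-- `u` is an intermediate integral of the second order differential equation `D`: the vector field
`D` is tangent to the section `u`. -/
def IsIntermediateIntegral (D : (p : TangentBundle (𝓡 n) M) → TangentSpace (𝓡 n).tangent p)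
    (u : (x : M) → TangentSpace (𝓡 n) x) : Prop :=
  ∀ x : M, D (sectionMap u x) ∈ LinearMap.range (dsection u x).toLinearMap

/-- The section `u` is Lagrangian for `ω_F`: `ω_F` specializes to zero on it. -/
def IsLagrangian (F : DiffForm (𝓡 n) M 2) (u : (x : M) → TangentSpace (𝓡 n) x) : Prop :=
  ∀ x : M, (g.omegaF F (sectionMap u x)).compContinuousLinearMap (dsection u x) = 0

/-- The Maxwell current `J = grad δF`. -/
def maxwellCurrent (F : DiffForm (𝓡 n) M 2) (x : M) : TangentSpace (𝓡 n) x :=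
  g.sharp x (g.codiff F x)

/-- `A` is, on the open set `U`, a (smooth) vector potential of `F`: `d(i_A g) = F`. -/
def IsVectorPotentialOn (F : DiffForm (𝓡 n) M 2) (A : (x : M) → TangentSpace (𝓡 n) x)
    (U : Set M) : Prop :=
  ContMDiffOn (𝓡 n) (𝓡 n).tangent ∞ (sectionMap A) U ∧ ∀ x ∈ U, (g.flat A).d x = F x

/-- The derivative `A(Ψ)` of a complex function along the vector field `A`. -/
def derivC (A : (x : M) → TangentSpace (𝓡 n) x) (Ψ : M → ℂ) (x : M) : ℂ :=
  mfderiv (𝓡 n) 𝓘(ℝ, ℂ) Ψ x (A x)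

/-- The function `Ψ` satisfies, at the point `x`, the Klein-Gordon equation
`(Δ - 2 i A - ‖A‖² + m²) Ψ = 0`, where `A` acts on functions as a derivation. -/
def KleinGordonAt (A : (x : M) → TangentSpace (𝓡 n) x) (m : ℂ) (Ψ : M → ℂ) (x : M) : Prop :=
  g.laplacianC Ψ x - 2 * Complex.I * derivC A Ψ x
    - (g.val x (A x) (A x) : ℂ) * Ψ x + m ^ 2 * Ψ x = 0

end PseudoRiemMetric

end

/-! Write `J` for the Maxwell current. The Liouville form is tautological: a section `u` satisfies
`u^*θ = i_u T₂`, and `π ∘ u = id` gives `u^*ω_F = d(i_u T₂) + F`. So the Lagrangian condition on `J`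
says `d(i_J T₂) = -F`, which is 1) (`d_flat_eq`, `d_flat_of_isLagrangian`).

For 2), tangency means that along the section `D = J_* w'` for some `w'`. Then `ω_F(D, J_* w)`
vanishes by the Lagrangian condition, and Newton's equation leaves `dT(J_* w) = 0`. Hence `T ∘ J`
has zero differential and is constant by connectedness (`val_eq_of_isIntermediateIntegral`).

For 3), `d(i_{J+A} T₂) = -F + F = 0`, and the Poincaré lemma in a coordinate ball produces `S`
(`exists_grad_eq`). If `grad S = J + A` is divergence free, then `ΔΨ = -‖J+A‖² Ψ` and `A(Ψ) = i⟨J+A,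
A⟩Ψ`, so the Klein-Gordon expression is `Ψ` times `-‖J+A‖² + 2⟨J+A, A⟩ - ‖A‖² + ‖J‖² = 0`
(`kleinGordonAt_exp`).

This uses that `J` is smooth with `div J = 0`, which is the longest part. In a fixed chart `√|g| Jʲ
= -∂ᵢ(√|g| Fⁱʲ)`, and `div J = 0` follows from the antisymmetry of `Fⁱʲ` and the symmetry of second
derivatives. But `δF` is defined at each point in the chart preferred there, so the formula has to
be shown independent of the chart. That is the Piola identity, applied to antisymmetric bivectors of
density one (`trace_fderiv_of_det_smul_eq`, `sum_fderiv_bivector_comp`, `codiffVec_transition`). The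
exterior derivative raises the same issue, settled by its naturality under pull-back
(`d_eq_extDeriv`). -/

noncomputable section

set_option linter.unusedSectionVars false

attribute [-instance]
  instNormedAddCommGroupOfRiemannianBundleOfIsTopologicalAddGroupOfContinuousConstSMulReal

/-! ### Charts, pull-back and naturality of the exterior derivative -/

section ChartDerivatives

open scoped Topology

variable {E : Type*} [NormedAddCommGroup E] [NormedSpace ℝ E]
  {H : Type*} [TopologicalSpace H] (I : ModelWithCorners ℝ E H)
  {N : Type*} [TopologicalSpace N] [ChartedSpace H N]

/-- The derivative at `z` of the chart at `x₀`. -/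
def chartD (x₀ z : N) : TangentSpace I z →L[ℝ] E :=
  mfderiv I 𝓘(ℝ, E) (extChartAt I x₀) z

/-- The derivative at `y` of the inverse of the chart at `x₀`. -/
def chartDsymm (x₀ : N) (y : E) : E →L[ℝ] TangentSpace I ((extChartAt I x₀).symm y) :=
  mfderivWithin 𝓘(ℝ, E) I (extChartAt I x₀).symm (range I) y

variable {I} [IsManifold I ∞ N]

theorem chartD_chartDsymm {x₀ : N} {y : E} (hy : y ∈ (extChartAt I x₀).target) (v : E) :
    chartD I x₀ ((extChartAt I x₀).symm y) (chartDsymm I x₀ y v) = v :=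
  DFunLike.congr_fun (mfderiv_extChartAt_comp_mfderivWithin_extChartAt_symm hy) v

theorem chartDsymm_chartD {x₀ : N} {y : E} (hy : y ∈ (extChartAt I x₀).target)
    (v : TangentSpace I ((extChartAt I x₀).symm y)) :
    chartDsymm I x₀ y (chartD I x₀ ((extChartAt I x₀).symm y) v) = v :=
  DFunLike.congr_fun (mfderivWithin_extChartAt_symm_comp_mfderiv_extChartAt hy) v

theorem chartD_injective {x₀ z : N} (hz : z ∈ (extChartAt I x₀).source) :
    Function.Injective (chartD I x₀ z) :=
  (isInvertible_mfderiv_extChartAt hz).injective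

theorem chartD_surjective {x₀ z : N} (hz : z ∈ (extChartAt I x₀).source) :
    Function.Surjective (chartD I x₀ z) :=
  (isInvertible_mfderiv_extChartAt hz).bijective.surjective

variable [I.Boundaryless]

theorem hasMFDerivAt_extChartAt_symm {x₀ : N} {y : E} (hy : y ∈ (extChartAt I x₀).target) :
    HasMFDerivAt 𝓘(ℝ, E) I (extChartAt I x₀).symm y (chartDsymm I x₀ y) := by
  have h := (mdifferentiableWithinAt_extChartAt_symm (I := I) hy).hasMFDerivWithinAt
  unfold chartDsymm
  rw [I.range_eq_univ] at h ⊢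
  exact h.hasMFDerivAt Filter.univ_mem

theorem extChartAt_target_mem_nhds_of_mem {x₀ : N} {y : E} (hy : y ∈ (extChartAt I x₀).target) :
    (extChartAt I x₀).target ∈ 𝓝 y :=
  (isOpen_extChartAt_target x₀).mem_nhds hy

section Maps

variable {E' : Type*} [NormedAddCommGroup E'] [NormedSpace ℝ E']
  {H' : Type*} [TopologicalSpace H'] {I' : ModelWithCorners ℝ E' H'}
  {N' : Type*} [TopologicalSpace N'] [ChartedSpace H' N'] [IsManifold I' ∞ N']
  [I'.Boundaryless]

theorem hasFDerivAt_chart_comp {f : N → N'} {x₀ : N} {y₀ : N'} {y : E}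
    (hy : y ∈ (extChartAt I x₀).target)
    (hfy : f ((extChartAt I x₀).symm y) ∈ (extChartAt I' y₀).source)
    (hf : MDifferentiableAt I I' f ((extChartAt I x₀).symm y)) :
    HasFDerivAt (fun y ↦ extChartAt I' y₀ (f ((extChartAt I x₀).symm y)))
      ((chartD I' y₀ (f ((extChartAt I x₀).symm y))).comp
        ((mfderiv I I' f ((extChartAt I x₀).symm y)).comp (chartDsymm I x₀ y))) y := by
  have h1 := (mdifferentiableAt_extChartAt (I := I') (by simpa using hfy)).hasMFDerivAt
  exact (h1.comp y (hf.hasMFDerivAt.comp y (hasMFDerivAt_extChartAt_symm hy))).hasFDerivAt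

theorem contDiffAt_chart_comp {f : N → N'} {x₀ : N} {y₀ : N'} {y : E}
    (hy : y ∈ (extChartAt I x₀).target)
    (hfy : f ((extChartAt I x₀).symm y) ∈ (extChartAt I' y₀).source)
    (hf : ContMDiffAt I I' ∞ f ((extChartAt I x₀).symm y)) :
    ContDiffAt ℝ ∞ (fun y ↦ extChartAt I' y₀ (f ((extChartAt I x₀).symm y))) y := by
  rw [← contMDiffAt_iff_contDiffAt]
  have h1 : ContMDiffAt I' 𝓘(ℝ, E') ∞ (extChartAt I' y₀) (f ((extChartAt I x₀).symm y)) :=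
    contMDiffAt_extChartAt' (by simpa using hfy)
  have h2 : ContMDiffAt 𝓘(ℝ, E) I ∞ (extChartAt I x₀).symm y :=
    (contMDiffOn_extChartAt_symm x₀).contMDiffAt (extChartAt_target_mem_nhds_of_mem hy)
  exact h1.comp y (hf.comp y h2)

theorem DiffForm.inChart_apply {k : ℕ} (η : DiffForm I N k) (x₀ : N) (y : E) (v : Fin k → E) :
    η.inChart x₀ y v = η ((extChartAt I x₀).symm y) (fun i ↦ chartDsymm I x₀ y (v i)) := rfl

theorem DiffForm.apply_eq_inChart {k : ℕ} (η : DiffForm I N k) {x₀ z : N}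
    (hz : z ∈ (extChartAt I x₀).source) (v : Fin k → TangentSpace I z) :
    η z v = η.inChart x₀ (extChartAt I x₀ z) (fun i ↦ chartD I x₀ z (v i)) := by
  obtain ⟨y, hy, rfl⟩ : ∃ y ∈ (extChartAt I x₀).target, (extChartAt I x₀).symm y = z :=
    ⟨_, (extChartAt I x₀).map_source hz, (extChartAt I x₀).left_inv hz⟩
  rw [(extChartAt I x₀).right_inv hy, DiffForm.inChart_apply]
  congr 1
  ext i
  rw [chartDsymm_chartD hy]

/-- The pull-back of a form by a map. -/
def DiffForm.pullback {k : ℕ} (f : N → N') (η : DiffForm I' N' k) : DiffForm I N k := fun z ↦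
  (η (f z)).compContinuousLinearMap (mfderiv I I' f z)

theorem DiffForm.inChart_pullback_apply {k : ℕ} {f : N → N'} (η : DiffForm I' N' k)
    {x₀ : N} {y₀ : N'} {y : E} (hy : y ∈ (extChartAt I x₀).target)
    (hfy : f ((extChartAt I x₀).symm y) ∈ (extChartAt I' y₀).source)
    (hf : MDifferentiableAt I I' f ((extChartAt I x₀).symm y)) :
    (DiffForm.pullback f η : DiffForm I N k).inChart x₀ y =
      (η.inChart y₀ (extChartAt I' y₀ (f ((extChartAt I x₀).symm y)))).compContinuousLinearMap
        (fderiv ℝ (fun y ↦ extChartAt I' y₀ (f ((extChartAt I x₀).symm y))) y) := by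
  ext v
  rw [(hasFDerivAt_chart_comp hy hfy hf).fderiv]
  exact η.apply_eq_inChart hfy _

theorem DiffForm.extDeriv_inChart_pullback {k : ℕ} {f : N → N'} (η : DiffForm I' N' k)
    {x₀ : N} {y₀ : N'} {y : E} (hy : y ∈ (extChartAt I x₀).target)
    (hfy : f ((extChartAt I x₀).symm y) ∈ (extChartAt I' y₀).source)
    (hf : ContMDiffAt I I' ∞ f ((extChartAt I x₀).symm y))
    (hη : DifferentiableAt ℝ (η.inChart y₀)
      (extChartAt I' y₀ (f ((extChartAt I x₀).symm y)))) :
    extDeriv ((DiffForm.pullback f η : DiffForm I N k).inChart x₀) y =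
      (extDeriv (η.inChart y₀)
        (extChartAt I' y₀ (f ((extChartAt I x₀).symm y)))).compContinuousLinearMap
        ((chartD I' y₀ (f ((extChartAt I x₀).symm y))).comp
          ((mfderiv I I' f ((extChartAt I x₀).symm y)).comp (chartDsymm I x₀ y))) := by
  have hfd := hf.mdifferentiableAt (by simp)
  -- The exterior derivative sees the form near `y`, so the coordinate formula for the pull-back is
  -- needed on a neighbourhood.
  have hev : ∀ᶠ y' in 𝓝 y, (DiffForm.pullback f η : DiffForm I N k).inChart x₀ y' =
      (η.inChart y₀ (extChartAt I' y₀ (f ((extChartAt I x₀).symm y')))).compContinuousLinearMap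
        (fderiv ℝ (fun y ↦ extChartAt I' y₀ (f ((extChartAt I x₀).symm y))) y') := by
    have hc : ContinuousAt (extChartAt I x₀).symm y := continuousAt_extChartAt_symm'' hy
    have h1 : ∀ᶠ z in 𝓝 ((extChartAt I x₀).symm y), ContMDiffAt I I' 1 f z :=
      (contMDiffAt_iff_contMDiffAt_nhds (by simp)).1 (hf.of_le (by exact_mod_cast le_top))
    have h2 : ∀ᶠ z in 𝓝 ((extChartAt I x₀).symm y), f z ∈ (extChartAt I' y₀).source :=
      hf.continuousAt ((isOpen_extChartAt_source y₀).mem_nhds hfy)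
    filter_upwards [extChartAt_target_mem_nhds_of_mem hy, hc.eventually h1, hc.eventually h2]
      with y' a1 a2 a3
    exact η.inChart_pullback_apply a1 a3 (a2.mdifferentiableAt (by simp))
  rw [Filter.EventuallyEq.extDeriv_eq hev,
    ← (hasFDerivAt_chart_comp hy hfy hfd).fderiv]
  exact extDeriv_pullback (f := fun y ↦ extChartAt I' y₀ (f ((extChartAt I x₀).symm y)))
    hη (contDiffAt_chart_comp hy hfy hf) (by simpa using ENat.LEInfty.out)

/-- The charts `x₀` and `y₀` are arbitrary, and the right side no longer involves `x₀`. This freedom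
is what makes `d` independent of the chart. -/
theorem DiffForm.extDeriv_inChart_pullback_comp {k : ℕ} {f : N → N'} (η : DiffForm I' N' k)
    {x₀ : N} {y₀ : N'} {z : N} (hz : z ∈ (extChartAt I x₀).source)
    (hfz : f z ∈ (extChartAt I' y₀).source) (hf : ContMDiffAt I I' ∞ f z)
    (hη : DifferentiableAt ℝ (η.inChart y₀) (extChartAt I' y₀ (f z))) :
    (extDeriv ((DiffForm.pullback f η : DiffForm I N k).inChart x₀)
        (extChartAt I x₀ z)).compContinuousLinearMap (chartD I x₀ z) =
      (extDeriv (η.inChart y₀) (extChartAt I' y₀ (f z))).compContinuousLinearMap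
        ((chartD I' y₀ (f z)).comp (mfderiv I I' f z)) := by
  obtain ⟨y, hy, rfl⟩ : ∃ y ∈ (extChartAt I x₀).target, (extChartAt I x₀).symm y = z :=
    ⟨_, (extChartAt I x₀).map_source hz, (extChartAt I x₀).left_inv hz⟩
  rw [(extChartAt I x₀).right_inv hy, η.extDeriv_inChart_pullback hy hfz hf hη]
  ext v
  simp only [ContinuousAlternatingMap.compContinuousLinearMap_apply, Function.comp_def,
    ContinuousLinearMap.comp_apply, chartDsymm_chartD hy]

theorem DiffForm.d_apply {k : ℕ} (η : DiffForm I N k) (z : N) :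
    η.d z = (extDeriv (η.inChart z) (extChartAt I z z)).compContinuousLinearMap
      (chartD I z z) := by
  unfold DiffForm.d
  rw [I.range_eq_univ, extDerivWithin_univ]
  rfl

theorem DiffForm.pullback_id {k : ℕ} (η : DiffForm I N k) :
    DiffForm.pullback (id : N → N) η = η := by
  funext z
  ext v
  simp only [DiffForm.pullback, mfderiv_id]
  rfl

/-- `d` is computed at each point in that point's own chart. Naturality for the identity map, with
different charts on the two sides, allows any other chart. -/
theorem DiffForm.d_eq_extDeriv {k : ℕ} (η : DiffForm I N k) {x₀ z : N}
    (hz : z ∈ (extChartAt I x₀).source)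
    (hη : DifferentiableAt ℝ (η.inChart x₀) (extChartAt I x₀ z)) :
    η.d z = (extDeriv (η.inChart x₀) (extChartAt I x₀ z)).compContinuousLinearMap
      (chartD I x₀ z) := by
  have h := η.extDeriv_inChart_pullback_comp (f := id) (mem_extChartAt_source (I := I) z) hz
    contMDiffAt_id hη
  rw [η.pullback_id] at h
  rw [DiffForm.d_apply, h, mfderiv_id]
  rfl

theorem DiffForm.d_pullback {k : ℕ} {f : N → N'} (η : DiffForm I' N' k) {z : N}
    (hf : ContMDiffAt I I' ∞ f z)
    (hη : DifferentiableAt ℝ (η.inChart (f z)) (extChartAt I' (f z) (f z))) :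
    (DiffForm.pullback f η : DiffForm I N k).d z =
      (η.d (f z)).compContinuousLinearMap (mfderiv I I' f z) := by
  rw [DiffForm.d_apply, η.extDeriv_inChart_pullback_comp (mem_extChartAt_source (I := I) z)
    (mem_extChartAt_source (I := I') (f z)) hf hη, DiffForm.d_apply]
  rfl

theorem DiffForm.d_congr {k : ℕ} {η η' : DiffForm I N k} {z : N} (h : ∀ᶠ w in 𝓝 z, η w = η' w) :
    η.d z = η'.d z := by
  rw [DiffForm.d_apply, DiffForm.d_apply]
  congr 1
  apply Filter.EventuallyEq.extDeriv_eq
  have hc : ContinuousAt (extChartAt I z).symm (extChartAt I z z) :=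
    continuousAt_extChartAt_symm z
  rw [ContinuousAt, extChartAt_to_inv] at hc
  filter_upwards [hc.eventually h] with y hy
  unfold DiffForm.inChart
  rw [hy]

end Maps

end ChartDerivatives

/-! ### Jacobi's formula and the Piola identity in Euclidean space -/

section Euclidean

open scoped Topology

variable {ι : Type*} [Fintype ι] [DecidableEq ι]

/-- The derivative of the determinant at the identity matrix is the trace. -/
theorem Matrix.hasFDerivAt_det_of_eq_one {V : Type*} [NormedAddCommGroup V] [NormedSpace ℝ V]
    {A : V → Matrix ι ι ℝ} {A' : ι → ι → V →L[ℝ] ℝ} {x : V} (hx : A x = 1)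
    (hA : ∀ i j, HasFDerivAt (fun y ↦ A y i j) (A' i j) x) :
    HasFDerivAt (fun y ↦ (A y).det) (∑ i, A' i i) x := by
  -- The determinant is multilinear in the rows, so its derivative is a sum of determinants with one
  -- row replaced. At the identity matrix each of them is a diagonal entry.
  let f : ContinuousMultilinearMap ℝ (fun _ : ι ↦ ι → ℝ) ℝ :=
    { toMultilinearMap := (Matrix.detRowAlternating (n := ι) (R := ℝ)).toMultilinearMap
      cont := Continuous.matrix_det continuous_id }
  obtain ⟨A, rfl⟩ : ∃ B : V → ι → ι → ℝ, A = fun y ↦ Matrix.of (B y) := ⟨A, rfl⟩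
  have hx' : Matrix.of (A x) = 1 := hx
  have hA1 : HasFDerivAt A
      (ContinuousLinearMap.pi fun i ↦ ContinuousLinearMap.pi fun j ↦ A' i j) x :=
    hasFDerivAt_pi.2 fun i ↦ hasFDerivAt_pi.2 fun j ↦ hA i j
  have h := (f.hasFDerivAt (A x)).comp x hA1
  refine h.congr_fderiv ?_
  ext v
  rw [ContinuousLinearMap.comp_apply, ContinuousMultilinearMap.linearDeriv_apply,
    _root_.sum_apply]
  refine Finset.sum_congr rfl fun i _ ↦ ?_
  change Matrix.det (Matrix.updateRow (Matrix.of (A x)) i (fun j ↦ A' i j v)) = A' i i v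
  rw [hx', ← Matrix.cramer_transpose_apply]
  simp [Matrix.cramer_one]

variable {n : ℕ}

local notation "𝔼" => EuclideanSpace ℝ (Fin n)

theorem EuclideanSpace.trace_eq_sum (L : 𝔼 →L[ℝ] 𝔼) :
    LinearMap.trace ℝ 𝔼 L.toLinearMap = ∑ i, L (EuclideanSpace.single i 1) i := by
  rw [LinearMap.trace_eq_sum_inner _ (EuclideanSpace.basisFun (Fin n) ℝ)]
  simp [EuclideanSpace.inner_single_left]

theorem EuclideanSpace.det_eq_det_of (L : 𝔼 →L[ℝ] 𝔼) :
    LinearMap.det L.toLinearMap =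
      (Matrix.of fun i j ↦ L (EuclideanSpace.single j 1) i).det := by
  rw [← LinearMap.det_toMatrix (EuclideanSpace.basisFun (Fin n) ℝ).toBasis]
  congr 1

/-- Jacobi's formula. Factoring `L y = L x ∘ (K ∘ L y)` reduces it to the derivative at the
identity. -/
theorem hasFDerivAt_det_comp {V : Type*} [NormedAddCommGroup V] [NormedSpace ℝ V]
    {L : V → 𝔼 →L[ℝ] 𝔼} {L' : V →L[ℝ] 𝔼 →L[ℝ] 𝔼} {x : V} (hL : HasFDerivAt L L' x)
    {K : 𝔼 →L[ℝ] 𝔼} (hK : ∀ v, L x (K v) = v) (hK' : ∀ v, K (L x v) = v) :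
    ∃ D : V →L[ℝ] ℝ, HasFDerivAt (fun y ↦ LinearMap.det (L y).toLinearMap) D x ∧
      ∀ v, D v = LinearMap.det (L x).toLinearMap * LinearMap.trace ℝ 𝔼 (K.comp (L' v)).toLinearMap := by
  have h1 : ∀ y, LinearMap.det (L y).toLinearMap = LinearMap.det (L x).toLinearMap *
      LinearMap.det (K.comp (L y)).toLinearMap := by
    intro y
    rw [← LinearMap.det_comp]
    congr 1
    ext v
    simp [hK]
  have h2 (i j : Fin n) : HasFDerivAt (fun y ↦ K (L y (EuclideanSpace.single j 1)) i)
      ((EuclideanSpace.proj i : 𝔼 →L[ℝ] ℝ).comp (K.comp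
        (L'.flip (EuclideanSpace.single j 1)))) x := by
    have := (hL.clm_apply (hasFDerivAt_const (EuclideanSpace.single j (1:ℝ)) x))
    have := ((EuclideanSpace.proj i : 𝔼 →L[ℝ] ℝ).hasFDerivAt.comp x (K.hasFDerivAt.comp x this))
    refine this.congr_fderiv ?_
    ext v
    simp
  have h3 := Matrix.hasFDerivAt_det_of_eq_one
    (A := fun y ↦ Matrix.of fun i j ↦ K (L y (EuclideanSpace.single j 1)) i)
    (x := x) (by ext i j; simp [hK', Matrix.one_apply]) h2
  refine ⟨_, (h3.const_mul (LinearMap.det (L x).toLinearMap)).congr_of_eventuallyEq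
    (Filter.Eventually.of_forall fun y ↦ ?_), fun v ↦ ?_⟩
  · dsimp only
    rw [h1, EuclideanSpace.det_eq_det_of (K.comp (L y))]
    rfl
  · rw [EuclideanSpace.trace_eq_sum]
    simp

/-- The Piola identity: the divergence of a vector field of density one does not depend on the
coordinates. -/
theorem trace_fderiv_of_det_smul_eq {τ Z X : 𝔼 → 𝔼} {y : 𝔼} (hτ : ContDiffAt ℝ 2 τ y)
    {K : 𝔼 →L[ℝ] 𝔼} (hK : ∀ v, fderiv ℝ τ y (K v) = v) (hK' : ∀ v, K (fderiv ℝ τ y v) = v)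
    (hZ : DifferentiableAt ℝ Z (τ y)) (hX : DifferentiableAt ℝ X y)
    (h : ∀ᶠ w in 𝓝 y, LinearMap.det (fderiv ℝ τ w).toLinearMap • Z (τ w) = fderiv ℝ τ w (X w)) :
    LinearMap.det (fderiv ℝ τ y).toLinearMap * LinearMap.trace ℝ 𝔼 (fderiv ℝ Z (τ y)).toLinearMap =
      LinearMap.trace ℝ 𝔼 (fderiv ℝ X y).toLinearMap := by
  have hL : HasFDerivAt (fderiv ℝ τ) (fderiv ℝ (fderiv ℝ τ) y) y :=
    ((hτ.fderiv_right (m := 1) (by norm_num)).differentiableAt (by simp)).hasFDerivAt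
  have hsymm : IsSymmSndFDerivAt ℝ τ y := hτ.isSymmSndFDerivAt (by simp)
  obtain ⟨D, hD, hDv⟩ := hasFDerivAt_det_comp hL hK hK'
  have hZτ := hZ.hasFDerivAt.comp y (hτ.differentiableAt (by simp)).hasFDerivAt
  have e1 := hD.smul hZτ
  have e2 := hL.clm_apply hX.hasFDerivAt
  have e3 := e1.unique (e2.congr_of_eventuallyEq h)
  have h0 := h.self_of_nhds
  set L := fderiv ℝ τ y
  set L2 := fderiv ℝ (fderiv ℝ τ) y
  set δ := LinearMap.det L.toLinearMap
  -- The hypothesis `h` differentiated at `y` in the direction `v`, with `K` applied. The symmetry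
  -- of the second derivative turns `L2 v (X y)` into `L2 (X y) v`.
  have key : ∀ v, LinearMap.trace ℝ 𝔼 (K.comp (L2 v)).toLinearMap • X y +
      δ • K (fderiv ℝ Z (τ y) (L v)) = K (L2 (X y) v) + fderiv ℝ X y v := by
    intro v
    have h1 := congrArg K (DFunLike.congr_fun e3 v)
    simp only [add_apply, smul_apply,
      ContinuousLinearMap.comp_apply, ContinuousLinearMap.smulRight_apply, hDv, map_add, map_smul,
      ContinuousLinearMap.flip_apply, Function.comp_apply, hK'] at h1
    have hx : X y = δ • K (Z (τ y)) := by rw [← map_smul, h0, hK']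
    calc _ = _ := by rw [hx, smul_smul, mul_comm _ δ, add_comm]
      _ = _ := h1
      _ = _ := by rw [hsymm (X y) v, add_comm]
  let φ : 𝔼 →ₗ[ℝ] ℝ :=
    { toFun := fun v ↦ LinearMap.trace ℝ 𝔼 (K.comp (L2 v)).toLinearMap
      map_add' := fun v w ↦ by simp
      map_smul' := fun c v ↦ by simp }
  -- Now take traces. The rank-one map `v ↦ φ v • X y` has trace `φ (X y)`, which cancels the trace
  -- of `K ∘ L2 (X y)`, and `K ∘ DZ ∘ L` has the trace of `DZ`.
  have key' : φ.smulRight (X y) + δ • (K.toLinearMap ∘ₗ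
      ((fderiv ℝ Z (τ y)).toLinearMap ∘ₗ L.toLinearMap)) =
      (K.comp (L2 (X y))).toLinearMap + (fderiv ℝ X y).toLinearMap := LinearMap.ext key
  have hLK : L.toLinearMap ∘ₗ K.toLinearMap = LinearMap.id := LinearMap.ext hK
  have := congrArg (LinearMap.trace ℝ 𝔼) key'
  rw [map_add, map_add, map_smul, LinearMap.trace_comp_comm', LinearMap.comp_assoc, hLK,
    LinearMap.comp_id, LinearMap.trace_smulRight] at this
  exact add_left_cancel this

theorem EuclideanSpace.fderiv_apply {V : Type*} [NormedAddCommGroup V] [NormedSpace ℝ V]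
    {Z : V → 𝔼} {z : V} (hZ : DifferentiableAt ℝ Z z) (i : Fin n) (v : V) :
    fderiv ℝ (fun w ↦ Z w i) z v = fderiv ℝ Z z v i := by
  have := ((EuclideanSpace.proj i : 𝔼 →L[ℝ] ℝ).hasFDerivAt.comp z hZ.hasFDerivAt).fderiv
  exact DFunLike.congr_fun this v

theorem EuclideanSpace.trace_fderiv {Z : 𝔼 → 𝔼} {z : 𝔼} (hZ : DifferentiableAt ℝ Z z) :
    LinearMap.trace ℝ 𝔼 (fderiv ℝ Z z).toLinearMap =
      ∑ i, fderiv ℝ (fun w ↦ Z w i) z (EuclideanSpace.single i 1) := by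
  rw [EuclideanSpace.trace_eq_sum]
  exact Finset.sum_congr rfl fun i _ ↦ (EuclideanSpace.fderiv_apply hZ i _).symm

theorem EuclideanSpace.sum_smul_single (v : 𝔼) :
    v = ∑ i, v i • (EuclideanSpace.single i 1 : 𝔼) := by
  have := (EuclideanSpace.basisFun (Fin n) ℝ).sum_repr v
  simpa using this.symm

theorem EuclideanSpace.clm_apply_eq_sum {V : Type*} [AddCommGroup V] [Module ℝ V]
    [TopologicalSpace V] (L : 𝔼 →L[ℝ] V) (v : 𝔼) :
    L v = ∑ i, v i • L (EuclideanSpace.single i 1) := by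
  conv_lhs => rw [EuclideanSpace.sum_smul_single v]
  simp

theorem Finset.sum_sum_mul_eq_zero_of_symm_of_antisymm {ι : Type*} [Fintype ι] {a b : ι → ι → ℝ}
    (ha : ∀ i j, a i j = a j i) (hb : ∀ i j, b i j = -b j i) : ∑ i, ∑ j, a i j * b i j = 0 := by
  have h : ∑ i, ∑ j, a i j * b i j = -∑ i, ∑ j, a i j * b i j := by
    conv_lhs => rw [Finset.sum_comm]
    rw [← Finset.sum_neg_distrib]
    refine Finset.sum_congr rfl fun i _ ↦ ?_
    rw [← Finset.sum_neg_distrib]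
    refine Finset.sum_congr rfl fun j _ ↦ ?_
    rw [ha j i, hb j i]
    ring
  linarith

/-- The divergence of an antisymmetric bivector field of density one is a vector field of density
one. -/
theorem sum_fderiv_bivector_comp {τ : 𝔼 → 𝔼} {P Q : 𝔼 → Fin n → Fin n → ℝ} {y : 𝔼}
    (hτ : ContDiffAt ℝ 2 τ y) {K : 𝔼 →L[ℝ] 𝔼} (hK : ∀ v, fderiv ℝ τ y (K v) = v)
    (hK' : ∀ v, K (fderiv ℝ τ y v) = v)
    (hP : ∀ i j, DifferentiableAt ℝ (fun w ↦ P w i j) y)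
    (hQ : ∀ i j, DifferentiableAt ℝ (fun w ↦ Q w i j) (τ y))
    (hanti : ∀ i j, P y i j = -P y j i)
    (h : ∀ᶠ w in 𝓝 y, ∀ a b, LinearMap.det (fderiv ℝ τ w).toLinearMap * Q (τ w) a b =
      ∑ i, ∑ j, fderiv ℝ τ w (EuclideanSpace.single i 1) a *
        fderiv ℝ τ w (EuclideanSpace.single j 1) b * P w i j) (b : Fin n) :
    LinearMap.det (fderiv ℝ τ y).toLinearMap *
        ∑ a, fderiv ℝ (fun w ↦ Q w a b) (τ y) (EuclideanSpace.single a 1) =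
      ∑ j, fderiv ℝ τ y (EuclideanSpace.single j 1) b *
        ∑ i, fderiv ℝ (fun w ↦ P w i j) y (EuclideanSpace.single i 1) := by
  -- With the upper index `b` fixed, the column of `Q` is a vector field of density one. Its
  -- counterpart upstairs contracts `P` with the differential of the `b`-th component of `τ`.
  let Z : 𝔼 → 𝔼 := fun z ↦ WithLp.toLp 2 fun a ↦ Q z a b
  let X : 𝔼 → 𝔼 := fun w ↦ WithLp.toLp 2 fun i ↦
    ∑ j, fderiv ℝ τ w (EuclideanSpace.single j 1) b * P w i j
  have hsymm : IsSymmSndFDerivAt ℝ τ y := hτ.isSymmSndFDerivAt (by simp)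
  have hL : DifferentiableAt ℝ (fderiv ℝ τ) y :=
    (hτ.fderiv_right (m := 1) (by norm_num)).differentiableAt (by simp)
  have hLe (j : Fin n) : DifferentiableAt ℝ (fun w ↦ fderiv ℝ τ w (EuclideanSpace.single j 1)) y :=
    hL.clm_apply (differentiableAt_const _)
  have hLij (j : Fin n) :
      DifferentiableAt ℝ (fun w ↦ fderiv ℝ τ w (EuclideanSpace.single j 1) b) y :=
    (EuclideanSpace.proj b : 𝔼 →L[ℝ] ℝ).differentiableAt.comp y (hLe j)
  have hterm (i j : Fin n) : DifferentiableAt ℝ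
      (fun w ↦ fderiv ℝ τ w (EuclideanSpace.single j 1) b * P w i j) y := (hLij j).mul (hP i j)
  have hZ : DifferentiableAt ℝ Z (τ y) :=
    (PiLp.continuousLinearEquiv 2 ℝ (fun _ : Fin n ↦ ℝ)).symm.differentiableAt.comp (τ y)
      (differentiableAt_pi.2 fun a ↦ hQ a b)
  have hX : DifferentiableAt ℝ X y :=
    (PiLp.continuousLinearEquiv 2 ℝ (fun _ : Fin n ↦ ℝ)).symm.differentiableAt.comp y
      (differentiableAt_pi.2 fun i ↦ DifferentiableAt.fun_sum fun j _ ↦ hterm i j)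
  have key := trace_fderiv_of_det_smul_eq hτ hK hK' hZ hX (by
    filter_upwards [h] with w hw
    ext a
    rw [EuclideanSpace.clm_apply_eq_sum (fderiv ℝ τ w) (X w)]
    simp only [PiLp.smul_apply, smul_eq_mul, Z, X, hw, WithLp.ofLp_sum, WithLp.ofLp_smul,
      Finset.sum_apply, Pi.smul_apply, Finset.sum_mul]
    exact Finset.sum_congr rfl fun i _ ↦ Finset.sum_congr rfl fun j _ ↦ by ring)
  rw [EuclideanSpace.trace_fderiv hZ, EuclideanSpace.trace_fderiv hX] at key
  refine key.trans ?_
  have hD (i : Fin n) : fderiv ℝ (fun w ↦ X w i) y (EuclideanSpace.single i 1) =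
      ∑ j, (fderiv ℝ (fderiv ℝ τ) y (EuclideanSpace.single i 1) (EuclideanSpace.single j 1) b *
        P y i j + fderiv ℝ τ y (EuclideanSpace.single j 1) b *
          fderiv ℝ (fun w ↦ P w i j) y (EuclideanSpace.single i 1)) := by
    simp only [X]
    rw [fderiv_fun_sum fun j _ ↦ hterm i j, _root_.sum_apply]
    refine Finset.sum_congr rfl fun j _ ↦ ?_
    rw [fderiv_fun_mul (hLij j) (hP i j)]
    simp only [add_apply, smul_apply, smul_eq_mul]
    rw [EuclideanSpace.fderiv_apply (hLe j), fderiv_clm_apply hL (differentiableAt_const _)]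
    simp
    ring
  simp only [hD, Finset.sum_add_distrib]
  -- The second derivatives of `τ` are symmetric in `i, j` and are contracted with the antisymmetric
  -- `P`, so they drop out.
  rw [Finset.sum_sum_mul_eq_zero_of_symm_of_antisymm (fun i j ↦ by rw [hsymm]) hanti, zero_add,
    Finset.sum_comm]
  simp only [Finset.mul_sum]

end Euclidean

/-! ### Smooth maps into the tangent bundle, read in a chart -/

section TangentCoordinates

open scoped Topology

variable {E : Type*} [NormedAddCommGroup E] [NormedSpace ℝ E]
  {H : Type*} [TopologicalSpace H] {I : ModelWithCorners ℝ E H}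
  {N : Type*} [TopologicalSpace N] [ChartedSpace H N] [IsManifold I ∞ N]

theorem trivializationAt_apply_eq_chartD {x₀ z : N} (hz : z ∈ (extChartAt I x₀).source)
    (v : TangentSpace I z) :
    (trivializationAt E (TangentSpace I : N → Type _) x₀ ⟨z, v⟩).2 = chartD I x₀ z v := by
  have hz' : z ∈ (chartAt H x₀).source := by simpa using hz
  have h := DFunLike.congr_fun (TangentBundle.continuousLinearMapAt_trivializationAt (I := I) hz') v
  rw [chartD, ← h, Trivialization.continuousLinearMapAt_apply, Trivialization.linearMapAt_apply,
    if_pos (by simpa using hz')]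

theorem contMDiffAt_tangent_iff {V : Type*} [NormedAddCommGroup V] [NormedSpace ℝ V]
    {H' : Type*} [TopologicalSpace H'] {I' : ModelWithCorners ℝ V H'}
    {N' : Type*} [TopologicalSpace N'] [ChartedSpace H' N'] {f : N' → TangentBundle I N} {y : N'}
    {x₀ : N} (hy : (f y).proj ∈ (extChartAt I x₀).source) :
    ContMDiffAt I' I.tangent ∞ f y ↔ ContMDiffAt I' I ∞ (fun w ↦ (f w).proj) y ∧
      ContMDiffAt I' 𝓘(ℝ, E) ∞ (fun w ↦ chartD I x₀ (f w).proj (f w).snd) y := by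
  have hy' : (f y).proj ∈ (chartAt H x₀).source := by simpa using hy
  rw [Trivialization.contMDiffAt_iff (e := trivializationAt E (TangentSpace I : N → Type _) x₀)
    (by rw [Trivialization.mem_source]; simpa using hy')]
  refine and_congr_right fun h ↦ Filter.EventuallyEq.contMDiffAt_iff ?_
  filter_upwards [h.continuousAt ((isOpen_extChartAt_source (I := I) x₀).mem_nhds hy)] with w hw
  exact trivializationAt_apply_eq_chartD hw (f w).snd

variable [I.Boundaryless]

/-- In the chart at `x₀` this field has the constant components `a`. -/
theorem contMDiffAt_chartDsymm {x₀ : N} {y : E} (hy : y ∈ (extChartAt I x₀).target) (a : E) :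
    ContMDiffAt 𝓘(ℝ, E) I.tangent ∞
      (fun w ↦ (⟨(extChartAt I x₀).symm w, chartDsymm I x₀ w a⟩ : TangentBundle I N)) y := by
  rw [contMDiffAt_tangent_iff (x₀ := x₀) ((extChartAt I x₀).map_target hy)]
  refine ⟨(contMDiffOn_extChartAt_symm x₀).contMDiffAt (extChartAt_target_mem_nhds_of_mem hy), ?_⟩
  refine (contMDiffAt_const (c := a)).congr_of_eventuallyEq ?_
  filter_upwards [extChartAt_target_mem_nhds_of_mem hy] with w hw
  exact chartD_chartDsymm hw a

theorem eventually_extChartAt_symm {x₀ z : N} (hz : z ∈ (extChartAt I x₀).source) {p : N → Prop}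
    (h : ∀ᶠ w in 𝓝 z, p w) :
    ∀ᶠ y in 𝓝 (extChartAt I x₀ z), p ((extChartAt I x₀).symm y) := by
  have hc : ContinuousAt (extChartAt I x₀).symm (extChartAt I x₀ z) :=
    continuousAt_extChartAt_symm' hz
  rw [ContinuousAt, (extChartAt I x₀).left_inv hz] at hc
  exact hc.eventually h

theorem eventually_extChartAt {x₀ z : N} (hz : z ∈ (extChartAt I x₀).source) {p : E → Prop}
    (h : ∀ᶠ y in 𝓝 (extChartAt I x₀ z), p y) :
    ∀ᶠ w in 𝓝 z, p (extChartAt I x₀ w) :=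
  (continuousAt_extChartAt' hz).eventually h

end TangentCoordinates

/-! ### Vector fields and the metric in a chart -/

namespace PseudoRiemMetric

open scoped Topology

variable {n : ℕ} {M : Type*} [TopologicalSpace M] [ChartedSpace (EuclideanSpace ℝ (Fin n)) M]
  [IsManifold (𝓡 n) ∞ M] (g : PseudoRiemMetric n M)

local notation "𝔼" => EuclideanSpace ℝ (Fin n)

theorem vecCoord_def (X : (x : M) → TangentSpace (𝓡 n) x) (x₀ : M) (y : 𝔼) :
    vecCoord X x₀ y =
      chartD (𝓡 n) x₀ ((extChartAt (𝓡 n) x₀).symm y) (X ((extChartAt (𝓡 n) x₀).symm y)) := rfl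

theorem vecCoord_extChartAt (X : (x : M) → TangentSpace (𝓡 n) x) {x₀ z : M}
    (hz : z ∈ (extChartAt (𝓡 n) x₀).source) :
    vecCoord X x₀ (extChartAt (𝓡 n) x₀ z) = chartD (𝓡 n) x₀ z (X z) := by
  rw [vecCoord_def, (extChartAt (𝓡 n) x₀).left_inv hz]

theorem contMDiffAt_sectionMap_iff {X : (x : M) → TangentSpace (𝓡 n) x} {x₀ z : M}
    (hz : z ∈ (extChartAt (𝓡 n) x₀).source) :
    ContMDiffAt (𝓡 n) (𝓡 n).tangent ∞ (sectionMap X) z ↔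
      ContDiffAt ℝ ∞ (vecCoord X x₀) (extChartAt (𝓡 n) x₀ z) := by
  rw [contMDiffAt_tangent_iff (x₀ := x₀) hz]
  have h1 : ContMDiffAt (𝓡 n) (𝓡 n) ∞ (fun w ↦ (sectionMap X w).proj) z := contMDiffAt_id
  have hφ : ContMDiffAt (𝓡 n) 𝓘(ℝ, 𝔼) ∞ (extChartAt (𝓡 n) x₀) z :=
    contMDiffAt_extChartAt' (by simpa using hz)
  have hψ : ContMDiffAt 𝓘(ℝ, 𝔼) (𝓡 n) ∞ (extChartAt (𝓡 n) x₀).symm (extChartAt (𝓡 n) x₀ z) :=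
    (contMDiffOn_extChartAt_symm x₀).contMDiffAt
      (extChartAt_target_mem_nhds_of_mem ((extChartAt (𝓡 n) x₀).map_source hz))
  rw [and_iff_right h1]
  refine ⟨fun h ↦ ?_, fun h ↦ ?_⟩
  · rw [← contMDiffAt_iff_contDiffAt]
    exact ContMDiffAt.comp_of_eq h hψ ((extChartAt (𝓡 n) x₀).left_inv hz)
  · refine (h.contMDiffAt.comp z hφ).congr_of_eventuallyEq ?_
    filter_upwards [(isOpen_extChartAt_source x₀).mem_nhds hz] with w hw
    exact (vecCoord_extChartAt X hw).symm

/-- The expression of the metric in the chart at `x₀`. -/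
def metricCoord (x₀ : M) (y : 𝔼) : 𝔼 →L[ℝ] 𝔼 →L[ℝ] ℝ :=
  (show 𝔼 →L[ℝ] 𝔼 →L[ℝ] ℝ from g.val ((extChartAt (𝓡 n) x₀).symm y)).bilinearComp
    (show 𝔼 →L[ℝ] 𝔼 from chartDsymm (𝓡 n) x₀ y) (show 𝔼 →L[ℝ] 𝔼 from chartDsymm (𝓡 n) x₀ y)

theorem metricCoord_apply (x₀ : M) (y v w : 𝔼) :
    g.metricCoord x₀ y v w = g.val ((extChartAt (𝓡 n) x₀).symm y)
      (chartDsymm (𝓡 n) x₀ y v) (chartDsymm (𝓡 n) x₀ y w) := rfl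

theorem metricCoord_symm (x₀ : M) (y v w : 𝔼) :
    g.metricCoord x₀ y v w = g.metricCoord x₀ y w v := g.symm _ _ _

theorem gram_apply (x₀ : M) (y : 𝔼) (i j : Fin n) :
    g.gram x₀ y i j = g.metricCoord x₀ y (EuclideanSpace.single i 1)
      (EuclideanSpace.single j 1) := rfl

theorem val_eq_metricCoord {x₀ z : M} (hz : z ∈ (extChartAt (𝓡 n) x₀).source)
    (v w : TangentSpace (𝓡 n) z) :
    g.val z v w = g.metricCoord x₀ (extChartAt (𝓡 n) x₀ z) (chartD (𝓡 n) x₀ z v)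
      (chartD (𝓡 n) x₀ z w) := by
  obtain ⟨y, hy, rfl⟩ : ∃ y ∈ (extChartAt (𝓡 n) x₀).target, (extChartAt (𝓡 n) x₀).symm y = z :=
    ⟨_, (extChartAt (𝓡 n) x₀).map_source hz, (extChartAt (𝓡 n) x₀).left_inv hz⟩
  rw [(extChartAt (𝓡 n) x₀).right_inv hy, metricCoord_apply, chartDsymm_chartD hy,
    chartDsymm_chartD hy]

/-- The base map `b` is general because two cases are needed: the inverse of a chart, for the
components of the metric, and the projection of the tangent bundle, for the kinetic energy. -/
theorem contMDiffAt_val {V : Type*} [NormedAddCommGroup V] [NormedSpace ℝ V]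
    {H' : Type*} [TopologicalSpace H'] {I' : ModelWithCorners ℝ V H'}
    {N' : Type*} [TopologicalSpace N'] [ChartedSpace H' N'] {b : N' → M}
    {v w : (y : N') → TangentSpace (𝓡 n) (b y)} {y : N'} (hb : ContMDiffAt I' (𝓡 n) ∞ b y)
    (hv : ContMDiffAt I' (𝓡 n).tangent ∞ (fun y ↦ (⟨b y, v y⟩ : TangentBundle (𝓡 n) M)) y)
    (hw : ContMDiffAt I' (𝓡 n).tangent ∞ (fun y ↦ (⟨b y, w y⟩ : TangentBundle (𝓡 n) M)) y) :
    ContMDiffAt I' 𝓘(ℝ, ℝ) ∞ (fun y ↦ g.val (b y) (v y) (w y)) y := by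
  have h1 := (g.contMDiff (b y)).comp y hb
  have h2 := ContMDiffAt.clm_bundle_apply₂ (F₃ := ℝ) (E₃ := Bundle.Trivial M ℝ)
    (ψ := fun y ↦ g.val (b y)) h1 hv hw
  rw [contMDiffAt_totalSpace] at h2
  exact h2.2

theorem contDiffOn_metricCoord (x₀ : M) :
    ContDiffOn ℝ ∞ (g.metricCoord x₀) (extChartAt (𝓡 n) x₀).target := by
  rw [contDiffOn_clm_apply]
  intro v
  rw [contDiffOn_clm_apply]
  intro w y hy
  refine ContDiffAt.contDiffWithinAt ?_
  rw [← contMDiffAt_iff_contDiffAt]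
  exact g.contMDiffAt_val
    ((contMDiffOn_extChartAt_symm x₀).contMDiffAt (extChartAt_target_mem_nhds_of_mem hy))
    (contMDiffAt_chartDsymm hy v) (contMDiffAt_chartDsymm hy w)

theorem metricCoord_eq_sum (x₀ : M) (y v w : 𝔼) :
    g.metricCoord x₀ y v w = ∑ i, ∑ j, v i * w j * g.gram x₀ y i j := by
  rw [EuclideanSpace.clm_apply_eq_sum (g.metricCoord x₀ y) v]
  simp only [_root_.sum_apply, smul_apply, smul_eq_mul]
  refine Finset.sum_congr rfl fun i _ ↦ ?_
  rw [EuclideanSpace.clm_apply_eq_sum _ w, Finset.mul_sum]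
  refine Finset.sum_congr rfl fun j _ ↦ ?_
  rw [gram_apply, smul_eq_mul, mul_assoc]

theorem metricCoord_nondegenerate {x₀ : M} {y : 𝔼} (hy : y ∈ (extChartAt (𝓡 n) x₀).target)
    {v : 𝔼} (hv : ∀ w, g.metricCoord x₀ y v w = 0) : v = 0 := by
  have h : chartDsymm (𝓡 n) x₀ y v = 0 := by
    apply g.nondegenerate
    intro w
    rw [← chartDsymm_chartD hy w]
    exact hv _
  rw [← chartD_chartDsymm hy v, h, map_zero]

theorem det_gram_ne_zero {x₀ : M} {y : 𝔼} (hy : y ∈ (extChartAt (𝓡 n) x₀).target) :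
    (g.gram x₀ y).det ≠ 0 := by
  intro h
  obtain ⟨v, hv, hv'⟩ := Matrix.exists_vecMul_eq_zero_iff.2 h
  apply hv
  have : WithLp.toLp 2 v = (0 : 𝔼) := by
    apply g.metricCoord_nondegenerate hy
    intro w
    rw [metricCoord_eq_sum, Finset.sum_comm]
    refine Finset.sum_eq_zero fun j _ ↦ ?_
    have := congrFun hv' j
    simp only [Matrix.vecMul, dotProduct, Pi.zero_apply] at this
    calc _ = w j * ∑ i, v i * g.gram x₀ y i j := by
          rw [Finset.mul_sum]
          exact Finset.sum_congr rfl fun i _ ↦ by simp; ring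
      _ = 0 := by rw [this, mul_zero]
  simpa using this

theorem gram_transpose (x₀ : M) (y : 𝔼) : (g.gram x₀ y).transpose = g.gram x₀ y := by
  ext i j
  exact g.symm _ _ _

theorem contDiffOn_gram (x₀ : M) (i j : Fin n) :
    ContDiffOn ℝ ∞ (fun y ↦ g.gram x₀ y i j) (extChartAt (𝓡 n) x₀).target :=
  ((g.contDiffOn_metricCoord x₀).clm_apply contDiffOn_const).clm_apply contDiffOn_const

theorem density_ne_zero {x₀ : M} {y : 𝔼} (hy : y ∈ (extChartAt (𝓡 n) x₀).target) :
    g.density x₀ y ≠ 0 :=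
  (Real.sqrt_pos.2 (abs_pos.2 (g.det_gram_ne_zero hy))).ne'

end PseudoRiemMetric

/-! ### Smoothness of the density and of the raised components -/

section MatrixSmooth

variable {V : Type*} [NormedAddCommGroup V] [NormedSpace ℝ V] {ι : Type*} [Fintype ι]
  [DecidableEq ι] {A : V → Matrix ι ι ℝ} {s : Set V} {m : WithTop ℕ∞}

theorem ContDiffOn.matrix_det (hA : ∀ i j, ContDiffOn ℝ m (fun y ↦ A y i j) s) :
    ContDiffOn ℝ m (fun y ↦ (A y).det) s := by
  simp only [Matrix.det_apply]
  exact ContDiffOn.sum fun σ _ ↦ (contDiffOn_prod fun i _ ↦ hA _ _).const_smul _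

theorem ContDiffOn.matrix_inv (hA : ∀ i j, ContDiffOn ℝ m (fun y ↦ A y i j) s)
    (hdet : ∀ y ∈ s, (A y).det ≠ 0) (i j : ι) : ContDiffOn ℝ m (fun y ↦ (A y)⁻¹ i j) s := by
  simp only [Matrix.inv_def, Matrix.smul_apply, Ring.inverse_eq_inv', Matrix.adjugate_apply,
    smul_eq_mul]
  refine ((ContDiffOn.matrix_det hA).inv hdet).mul (ContDiffOn.matrix_det fun k l ↦ ?_)
  simp only [Matrix.updateRow_apply]
  split_ifs
  · exact contDiffOn_const
  · exact hA k l

end MatrixSmooth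

namespace PseudoRiemMetric

open scoped Topology

variable {n : ℕ} {M : Type*} [TopologicalSpace M] [ChartedSpace (EuclideanSpace ℝ (Fin n)) M]
  [IsManifold (𝓡 n) ∞ M] (g : PseudoRiemMetric n M)

local notation "𝔼" => EuclideanSpace ℝ (Fin n)

theorem contDiffOn_density (x₀ : M) :
    ContDiffOn ℝ ∞ (g.density x₀) (extChartAt (𝓡 n) x₀).target := by
  have h := ContDiffOn.matrix_det (A := g.gram x₀) (g.contDiffOn_gram x₀)
  exact (h.abs fun y hy ↦ g.det_gram_ne_zero hy).sqrt
    fun y hy ↦ abs_ne_zero.2 (g.det_gram_ne_zero hy)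

/-- The components of a 2-form in the chart at `x₀`. -/
def formMatrix (F : DiffForm (𝓡 n) M 2) (x₀ : M) (y : 𝔼) : Matrix (Fin n) (Fin n) ℝ :=
  Matrix.of fun a b ↦ F.inChart x₀ y ![EuclideanSpace.single a 1, EuclideanSpace.single b 1]

theorem raised_eq (F : DiffForm (𝓡 n) M 2) (x₀ : M) (y : 𝔼) :
    g.raised F x₀ y = (g.gram x₀ y)⁻¹ * formMatrix F x₀ y * ((g.gram x₀ y)⁻¹).transpose := by
  unfold raised formMatrix
  congr 3
  ext a b
  simp only [DiffForm.inChart_apply]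
  congr 1
  ext i
  fin_cases i <;> rfl

theorem contDiffOn_raised {F : DiffForm (𝓡 n) M 2} (hF : F.IsSmooth) (x₀ : M) (i j : Fin n) :
    ContDiffOn ℝ ∞ (fun y ↦ g.raised F x₀ y i j) (extChartAt (𝓡 n) x₀).target := by
  have hinv := ContDiffOn.matrix_inv (A := g.gram x₀) (g.contDiffOn_gram x₀)
    (fun y hy ↦ g.det_gram_ne_zero hy)
  have hform (a b : Fin n) :
      ContDiffOn ℝ ∞ (fun y ↦ formMatrix F x₀ y a b) (extChartAt (𝓡 n) x₀).target :=
    (ContinuousAlternatingMap.apply ℝ 𝔼 ℝ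
      ![EuclideanSpace.single a (1 : ℝ), EuclideanSpace.single b 1]).contDiff.comp_contDiffOn
      (hF x₀)
  simp only [raised_eq, Matrix.mul_apply, Matrix.transpose_apply]
  exact ContDiffOn.sum fun k _ ↦ (ContDiffOn.sum fun l _ ↦ (hinv i l).mul (hform l k)).mul
    (hinv j k)

theorem formMatrix_transpose (F : DiffForm (𝓡 n) M 2) (x₀ : M) (y : 𝔼) :
    (formMatrix F x₀ y).transpose = -formMatrix F x₀ y := by
  ext a b
  have := (F.inChart x₀ y).map_swap ![EuclideanSpace.single a 1, EuclideanSpace.single b 1]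
    (i := 0) (j := 1) (by simp)
  change F.inChart x₀ y ![EuclideanSpace.single b 1, EuclideanSpace.single a 1] =
    -F.inChart x₀ y ![EuclideanSpace.single a 1, EuclideanSpace.single b 1]
  refine Eq.trans (congrArg (F.inChart x₀ y) ?_) this
  ext i
  fin_cases i <;> simp

theorem raised_transpose (F : DiffForm (𝓡 n) M 2) (x₀ : M) (y : 𝔼) :
    (g.raised F x₀ y).transpose = -g.raised F x₀ y := by
  rw [raised_eq, Matrix.transpose_mul, Matrix.transpose_mul, Matrix.transpose_transpose,
    formMatrix_transpose, Matrix.neg_mul, Matrix.mul_neg, Matrix.mul_assoc]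

end PseudoRiemMetric

theorem ContinuousAlternatingMap.apply_vec2_eq_sum {n : ℕ}
    (η : EuclideanSpace ℝ (Fin n) [⋀^Fin 2]→L[ℝ] ℝ) (v w : EuclideanSpace ℝ (Fin n)) :
    η ![v, w] = ∑ i, ∑ j, v i * w j *
      η ![EuclideanSpace.single i 1, EuclideanSpace.single j 1] := by
  have h1 (v w : EuclideanSpace ℝ (Fin n)) :
      η.toContinuousMultilinearMap.toContinuousLinearMap ![0, w] 0 v = η ![v, w] := by
    change η (Function.update ![0, w] 0 v) = _
    congr 1
    ext i
    fin_cases i <;> simp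
  have h2 (v w : EuclideanSpace ℝ (Fin n)) :
      η.toContinuousMultilinearMap.toContinuousLinearMap ![v, 0] 1 w = η ![v, w] := by
    change η (Function.update ![v, 0] 1 w) = _
    congr 1
    ext i
    fin_cases i <;> simp
  rw [← h1, EuclideanSpace.clm_apply_eq_sum]
  refine Finset.sum_congr rfl fun i _ ↦ ?_
  rw [h1, ← h2, EuclideanSpace.clm_apply_eq_sum, smul_eq_mul, Finset.mul_sum]
  refine Finset.sum_congr rfl fun j _ ↦ ?_
  rw [h2, smul_eq_mul, mul_assoc]

/-! ### Change of coordinates for the metric, its density and 2-forms -/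

namespace PseudoRiemMetric

open scoped Topology

variable {n : ℕ} {M : Type*} [TopologicalSpace M] [ChartedSpace (EuclideanSpace ℝ (Fin n)) M]
  [IsManifold (𝓡 n) ∞ M] (g : PseudoRiemMetric n M)

local notation "𝔼" => EuclideanSpace ℝ (Fin n)

/-- The change of coordinates from the chart at `x₁` to the chart at `x₀`. -/
def transition (x₁ x₀ : M) (y : 𝔼) : 𝔼 := extChartAt (𝓡 n) x₀ ((extChartAt (𝓡 n) x₁).symm y)

variable {x₀ x₁ : M} {y : EuclideanSpace ℝ (Fin n)}

theorem hasFDerivAt_transition (hy : y ∈ (extChartAt (𝓡 n) x₁).target)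
    (hy' : (extChartAt (𝓡 n) x₁).symm y ∈ (extChartAt (𝓡 n) x₀).source) :
    HasFDerivAt (transition x₁ x₀) ((chartD (𝓡 n) x₀ ((extChartAt (𝓡 n) x₁).symm y)).comp
      (chartDsymm (𝓡 n) x₁ y)) y := by
  have h := hasFDerivAt_chart_comp (f := id) (I := 𝓡 n) (I' := 𝓡 n) hy hy' mdifferentiableAt_id
  rw [mfderiv_id] at h
  exact h

theorem fderiv_transition_apply (hy : y ∈ (extChartAt (𝓡 n) x₁).target)
    (hy' : (extChartAt (𝓡 n) x₁).symm y ∈ (extChartAt (𝓡 n) x₀).source) (v : 𝔼) :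
    fderiv ℝ (transition x₁ x₀) y v =
      chartD (𝓡 n) x₀ ((extChartAt (𝓡 n) x₁).symm y) (chartDsymm (𝓡 n) x₁ y v) := by
  rw [(hasFDerivAt_transition hy hy').fderiv]
  rfl

theorem contDiffAt_transition (hy : y ∈ (extChartAt (𝓡 n) x₁).target)
    (hy' : (extChartAt (𝓡 n) x₁).symm y ∈ (extChartAt (𝓡 n) x₀).source) :
    ContDiffAt ℝ ∞ (transition x₁ x₀) y :=
  contDiffAt_chart_comp (f := id) (I := 𝓡 n) (I' := 𝓡 n) hy hy' contMDiffAt_id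

theorem exists_inverse_fderiv_transition (hy : y ∈ (extChartAt (𝓡 n) x₁).target)
    (hy' : (extChartAt (𝓡 n) x₁).symm y ∈ (extChartAt (𝓡 n) x₀).source) :
    ∃ K : 𝔼 →L[ℝ] 𝔼, (∀ v, fderiv ℝ (transition x₁ x₀) y (K v) = v) ∧
      ∀ v, K (fderiv ℝ (transition x₁ x₀) y v) = v := by
  have hinj : Function.Injective (fderiv ℝ (transition x₁ x₀) y) := by
    rw [(hasFDerivAt_transition hy hy').fderiv]
    exact (chartD_injective hy').comp
      (Function.LeftInverse.injective (chartD_chartDsymm (I := 𝓡 n) hy))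
  let e : 𝔼 ≃ₗ[ℝ] 𝔼 := LinearEquiv.ofInjectiveEndo
    (fderiv ℝ (transition x₁ x₀) y).toLinearMap hinj
  exact ⟨LinearMap.toContinuousLinearMap e.symm.toLinearMap,
    fun v ↦ e.apply_symm_apply v, fun v ↦ e.symm_apply_apply v⟩

/-- The Jacobian matrix of a change of coordinates. -/
def jacobian (x₁ x₀ : M) (y : 𝔼) : Matrix (Fin n) (Fin n) ℝ :=
  Matrix.of fun a i ↦ fderiv ℝ (transition x₁ x₀) y (EuclideanSpace.single i 1) a

theorem jacobian_apply (x₁ x₀ : M) (y : 𝔼) (a i : Fin n) :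
    jacobian x₁ x₀ y a i = fderiv ℝ (transition x₁ x₀) y (EuclideanSpace.single i 1) a := rfl

theorem det_jacobian (x₁ x₀ : M) (y : 𝔼) :
    LinearMap.det (fderiv ℝ (transition x₁ x₀) y).toLinearMap = (jacobian x₁ x₀ y).det :=
  EuclideanSpace.det_eq_det_of _

theorem det_jacobian_ne_zero (hy : y ∈ (extChartAt (𝓡 n) x₁).target)
    (hy' : (extChartAt (𝓡 n) x₁).symm y ∈ (extChartAt (𝓡 n) x₀).source) :
    (jacobian x₁ x₀ y).det ≠ 0 := by
  obtain ⟨K, hK, -⟩ := exists_inverse_fderiv_transition hy hy'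
  rw [← det_jacobian]
  have h : (fderiv ℝ (transition x₁ x₀) y).toLinearMap ∘ₗ K.toLinearMap = LinearMap.id :=
    LinearMap.ext hK
  have h' := congrArg LinearMap.det h
  rw [LinearMap.det_comp, LinearMap.det_id] at h'
  exact left_ne_zero_of_mul_eq_one h'

theorem metricCoord_transition (hy : y ∈ (extChartAt (𝓡 n) x₁).target)
    (hy' : (extChartAt (𝓡 n) x₁).symm y ∈ (extChartAt (𝓡 n) x₀).source) (v w : 𝔼) :
    g.metricCoord x₁ y v w = g.metricCoord x₀ (transition x₁ x₀ y)
      (fderiv ℝ (transition x₁ x₀) y v) (fderiv ℝ (transition x₁ x₀) y w) := by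
  rw [metricCoord_apply, g.val_eq_metricCoord hy', fderiv_transition_apply hy hy',
    fderiv_transition_apply hy hy']
  rfl

theorem gram_transition (hy : y ∈ (extChartAt (𝓡 n) x₁).target)
    (hy' : (extChartAt (𝓡 n) x₁).symm y ∈ (extChartAt (𝓡 n) x₀).source) :
    g.gram x₁ y = (jacobian x₁ x₀ y).transpose * g.gram x₀ (transition x₁ x₀ y) *
      jacobian x₁ x₀ y := by
  ext i j
  rw [gram_apply, g.metricCoord_transition hy hy', metricCoord_eq_sum, Finset.sum_comm]
  simp only [Matrix.mul_apply, Matrix.transpose_apply, jacobian_apply, Finset.sum_mul]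
  exact Finset.sum_congr rfl fun a _ ↦ Finset.sum_congr rfl fun b _ ↦ by ring

theorem formMatrix_transition (F : DiffForm (𝓡 n) M 2) (hy : y ∈ (extChartAt (𝓡 n) x₁).target)
    (hy' : (extChartAt (𝓡 n) x₁).symm y ∈ (extChartAt (𝓡 n) x₀).source) :
    formMatrix F x₁ y = (jacobian x₁ x₀ y).transpose * formMatrix F x₀ (transition x₁ x₀ y) *
      jacobian x₁ x₀ y := by
  ext i j
  have h (v w : 𝔼) : F.inChart x₁ y ![v, w] = F.inChart x₀ (transition x₁ x₀ y)
      ![fderiv ℝ (transition x₁ x₀) y v, fderiv ℝ (transition x₁ x₀) y w] := by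
    rw [DiffForm.inChart_apply, F.apply_eq_inChart hy', fderiv_transition_apply hy hy',
      fderiv_transition_apply hy hy']
    refine congrArg (F.inChart x₀ (transition x₁ x₀ y)) ?_
    ext1 i
    fin_cases i <;> rfl
  change F.inChart x₁ y ![EuclideanSpace.single i 1, EuclideanSpace.single j 1] = _
  rw [h, ContinuousAlternatingMap.apply_vec2_eq_sum, Finset.sum_comm]
  simp only [Matrix.mul_apply, Matrix.transpose_apply, jacobian_apply, Finset.sum_mul]
  refine Finset.sum_congr rfl fun a _ ↦ Finset.sum_congr rfl fun b _ ↦ ?_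
  rw [mul_right_comm]
  rfl

/-- The determinant of the Gram matrix acquires the square of the Jacobian determinant, hence the
absolute value after the square root. -/
theorem density_transition (hy : y ∈ (extChartAt (𝓡 n) x₁).target)
    (hy' : (extChartAt (𝓡 n) x₁).symm y ∈ (extChartAt (𝓡 n) x₀).source) :
    g.density x₁ y = |(jacobian x₁ x₀ y).det| * g.density x₀ (transition x₁ x₀ y) := by
  unfold density
  rw [g.gram_transition hy hy', Matrix.det_mul, Matrix.det_mul, Matrix.det_transpose,
    ← Real.sqrt_sq (abs_nonneg (jacobian x₁ x₀ y).det), ← Real.sqrt_mul (sq_nonneg _)]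
  congr 1
  rw [abs_mul, abs_mul]
  ring

/-- The metric and the form are both covariant. After the two inversions of the metric one Jacobian
survives on each side, as for a contravariant bivector. -/
theorem raised_transition (F : DiffForm (𝓡 n) M 2) (hy : y ∈ (extChartAt (𝓡 n) x₁).target)
    (hy' : (extChartAt (𝓡 n) x₁).symm y ∈ (extChartAt (𝓡 n) x₀).source) :
    g.raised F x₀ (transition x₁ x₀ y) =
      jacobian x₁ x₀ y * g.raised F x₁ y * (jacobian x₁ x₀ y).transpose := by
  have hT : IsUnit (jacobian x₁ x₀ y).det := (det_jacobian_ne_zero hy hy').isUnit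
  have hT' : IsUnit (jacobian x₁ x₀ y).transpose.det := by rwa [Matrix.det_transpose]
  rw [raised_eq, raised_eq, g.gram_transition hy hy', formMatrix_transition F hy hy']
  simp only [Matrix.mul_inv_rev, Matrix.transpose_mul, Matrix.transpose_nonsing_inv,
    Matrix.transpose_transpose, Matrix.mul_assoc, gram_transpose]
  simp only [Matrix.mul_nonsing_inv_cancel_left _ _ hT, Matrix.nonsing_inv_mul_cancel_left _ _ hT',
    Matrix.nonsing_inv_mul _ hT', Matrix.mul_one]

/-! ### The codifferential as a vector field, and the Maxwell current -/

/-- The components `-∇ᵢ Fⁱʲ` of the codifferential in the chart at `x₀`. -/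
def codiffVec (F : DiffForm (𝓡 n) M 2) (x₀ : M) (y : 𝔼) : 𝔼 :=
  WithLp.toLp 2 fun j ↦ -((g.density x₀ y)⁻¹ *
    ∑ i, fderiv ℝ (fun y ↦ g.density x₀ y * g.raised F x₀ y i j) y (EuclideanSpace.single i 1))

theorem contDiffOn_density_mul_raised {F : DiffForm (𝓡 n) M 2} (hF : F.IsSmooth) (x₀ : M)
    (i j : Fin n) : ContDiffOn ℝ ∞ (fun y ↦ g.density x₀ y * g.raised F x₀ y i j)
      (extChartAt (𝓡 n) x₀).target :=
  (g.contDiffOn_density x₀).mul (g.contDiffOn_raised hF x₀ i j)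

theorem contDiffOn_fderiv_density_mul_raised {F : DiffForm (𝓡 n) M 2} (hF : F.IsSmooth) (x₀ : M)
    (i j : Fin n) : ContDiffOn ℝ ∞ (fderiv ℝ (fun y ↦ g.density x₀ y * g.raised F x₀ y i j))
      (extChartAt (𝓡 n) x₀).target :=
  ((contDiffOn_infty_iff_fderiv_of_isOpen (isOpen_extChartAt_target x₀)).1
    (g.contDiffOn_density_mul_raised hF x₀ i j)).2

theorem contDiffOn_codiffVec {F : DiffForm (𝓡 n) M 2} (hF : F.IsSmooth) (x₀ : M) :
    ContDiffOn ℝ ∞ (g.codiffVec F x₀) (extChartAt (𝓡 n) x₀).target := by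
  rw [contDiffOn_piLp]
  intro j
  exact (((g.contDiffOn_density x₀).inv fun y hy ↦ g.density_ne_zero hy).mul
    (ContDiffOn.sum fun i _ ↦ (g.contDiffOn_fderiv_density_mul_raised hF x₀ i j).clm_apply
      contDiffOn_const)).neg

/-- `√|g| Fⁱʲ` is an antisymmetric bivector of density one up to sign, so its divergence is a vector
field of density one up to the same sign. Dividing by the density leaves a genuine vector. -/
theorem codiffVec_transition {F : DiffForm (𝓡 n) M 2} (hF : F.IsSmooth)
    (hy : y ∈ (extChartAt (𝓡 n) x₁).target)
    (hy' : (extChartAt (𝓡 n) x₁).symm y ∈ (extChartAt (𝓡 n) x₀).source) :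
    g.codiffVec F x₀ (transition x₁ x₀ y) =
      fderiv ℝ (transition x₁ x₀) y (g.codiffVec F x₁ y) := by
  obtain ⟨K, hK, hK'⟩ := exists_inverse_fderiv_transition hy hy'
  have hτ := contDiffAt_transition hy hy'
  have hdet0 := det_jacobian_ne_zero hy hy'
  have hy0 : transition x₁ x₀ y ∈ (extChartAt (𝓡 n) x₀).target :=
    (extChartAt (𝓡 n) x₀).map_source hy'
  -- The density scales with `|det|`, the Piola identity with `det`. The sign of the Jacobian
  -- determinant is constant near `y`, and the constant `ε` absorbs it.
  obtain ⟨ε, hε⟩ : ∃ ε : ℝ, ∀ᶠ w in 𝓝 y, |(jacobian x₁ x₀ w).det| =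
      (jacobian x₁ x₀ w).det * ε := by
    have hc : ContinuousAt (fun w ↦ (jacobian x₁ x₀ w).det) y := by
      simp only [← det_jacobian]
      have hL : DifferentiableAt ℝ (fderiv ℝ (transition x₁ x₀)) y :=
        (hτ.fderiv_right (m := ∞) (by simp)).differentiableAt (by simp)
      obtain ⟨D, hD, -⟩ := hasFDerivAt_det_comp hL.hasFDerivAt hK hK'
      exact hD.continuousAt
    rcases lt_or_gt_of_ne hdet0 with h | h
    · refine ⟨-1, ?_⟩
      filter_upwards [hc.eventually (gt_mem_nhds h)] with w hw
      rw [abs_of_neg hw]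
      ring
    · refine ⟨1, ?_⟩
      filter_upwards [hc.eventually (lt_mem_nhds h)] with w hw
      rw [abs_of_pos hw]
      ring
  have hd {x : M} {w : 𝔼} (hw : w ∈ (extChartAt (𝓡 n) x).target) (i j : Fin n) :
      DifferentiableAt ℝ (fun w ↦ g.density x w * g.raised F x w i j) w :=
    ((g.contDiffOn_density_mul_raised hF x i j).contDiffAt
      (extChartAt_target_mem_nhds_of_mem hw)).differentiableAt (by simp)
  have key := sum_fderiv_bivector_comp (τ := transition x₁ x₀)
    (P := fun w i j ↦ g.density x₁ w * g.raised F x₁ w i j)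
    (Q := fun w i j ↦ ε * (g.density x₀ w * g.raised F x₀ w i j))
    (hτ.of_le (by simpa using ENat.LEInfty.out)) hK hK' (hd hy)
    (fun i j ↦ (hd hy0 i j).const_mul ε)
    (fun i j ↦ by
      have := congrFun (congrFun (g.raised_transpose F x₁ y) j) i
      simp only [Matrix.transpose_apply, Matrix.neg_apply] at this
      rw [this]
      ring)
    (by
      have hev : ∀ᶠ w in 𝓝 y, (extChartAt (𝓡 n) x₁).symm w ∈ (extChartAt (𝓡 n) x₀).source :=
        (continuousAt_extChartAt_symm'' hy) ((isOpen_extChartAt_source x₀).mem_nhds hy')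
      filter_upwards [hε, extChartAt_target_mem_nhds_of_mem hy, hev] with w h1 h2 h3 a b
      rw [det_jacobian, ← mul_assoc, ← mul_assoc, ← h1, ← g.density_transition h2 h3,
        g.raised_transition F h2 h3, Matrix.mul_apply, Finset.mul_sum, Finset.sum_comm]
      refine Finset.sum_congr rfl fun j _ ↦ ?_
      rw [Matrix.mul_apply, Finset.sum_mul, Finset.mul_sum]
      refine Finset.sum_congr rfl fun i _ ↦ ?_
      rw [jacobian_apply, Matrix.transpose_apply, jacobian_apply]
      ring)
  ext b
  have hb := key b
  have hpull (a : Fin n) : fderiv ℝ (fun w ↦ ε * (g.density x₀ w * g.raised F x₀ w a b))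
      (transition x₁ x₀ y) (EuclideanSpace.single a 1) =
      ε * fderiv ℝ (fun w ↦ g.density x₀ w * g.raised F x₀ w a b)
        (transition x₁ x₀ y) (EuclideanSpace.single a 1) := by
    rw [fderiv_const_mul (hd hy0 a b)]
    rfl
  simp only [hpull] at hb
  rw [← Finset.mul_sum, ← mul_assoc, det_jacobian, ← hε.self_of_nhds] at hb
  rw [EuclideanSpace.clm_apply_eq_sum _ (g.codiffVec F x₁ y)]
  simp only [codiffVec, WithLp.ofLp_sum, WithLp.ofLp_smul, Finset.sum_apply, Pi.smul_apply,
    smul_eq_mul]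
  have hd1 := g.density_ne_zero hy
  have hd0 := g.density_ne_zero hy0
  have e1 : ∑ x, -((g.density x₁ y)⁻¹ * ∑ i, fderiv ℝ
      (fun y ↦ g.density x₁ y * g.raised F x₁ y i x) y (EuclideanSpace.single i 1)) *
        fderiv ℝ (transition x₁ x₀) y (EuclideanSpace.single x 1) b =
      -((g.density x₁ y)⁻¹ * ∑ j, fderiv ℝ (transition x₁ x₀) y (EuclideanSpace.single j 1) b *
        ∑ i, fderiv ℝ (fun y ↦ g.density x₁ y * g.raised F x₁ y i j) y
          (EuclideanSpace.single i 1)) := by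
    rw [Finset.mul_sum, ← Finset.sum_neg_distrib]
    exact Finset.sum_congr rfl fun j _ ↦ by ring
  rw [e1, ← hb, g.density_transition hy hy']
  have := abs_ne_zero.2 hdet0
  field_simp

theorem chartD_eq_codiffVec {F : DiffForm (𝓡 n) M 2} (hF : F.IsSmooth) {z : M}
    (hz₁ : z ∈ (extChartAt (𝓡 n) x₁).source) (hz₀ : z ∈ (extChartAt (𝓡 n) x₀).source)
    {v : TangentSpace (𝓡 n) z}
    (hv : chartD (𝓡 n) x₁ z v = g.codiffVec F x₁ (extChartAt (𝓡 n) x₁ z)) :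
    chartD (𝓡 n) x₀ z v = g.codiffVec F x₀ (extChartAt (𝓡 n) x₀ z) := by
  obtain ⟨y, hy, rfl⟩ : ∃ y ∈ (extChartAt (𝓡 n) x₁).target, (extChartAt (𝓡 n) x₁).symm y = z :=
    ⟨_, (extChartAt (𝓡 n) x₁).map_source hz₁, (extChartAt (𝓡 n) x₁).left_inv hz₁⟩
  rw [(extChartAt (𝓡 n) x₁).right_inv hy] at hv
  have h := g.codiffVec_transition hF hy hz₀
  rw [← hv, fderiv_transition_apply hy hz₀, chartDsymm_chartD hy] at h
  exact h.symm

theorem codiff_apply (F : DiffForm (𝓡 n) M 2) (z : M) (w : TangentSpace (𝓡 n) z) :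
    g.codiff F z w = g.metricCoord z (extChartAt (𝓡 n) z z)
      (g.codiffVec F z (extChartAt (𝓡 n) z z)) (chartD (𝓡 n) z z w) := by
  rw [metricCoord_symm, metricCoord_eq_sum]
  unfold codiff
  simp only [_root_.sum_apply, smul_apply, smul_eq_mul]
  refine Finset.sum_congr rfl fun k _ ↦ Finset.sum_congr rfl fun j _ ↦ ?_
  have h1 : g.codiffVec F z (extChartAt (𝓡 n) z z) j = g.codiffCoord F z j := rfl
  rw [h1]
  have h2 : ((EuclideanSpace.proj k : 𝔼 →L[ℝ] ℝ).comp
      (mfderiv (𝓡 n) 𝓘(ℝ, 𝔼) (extChartAt (𝓡 n) z) z)) w = chartD (𝓡 n) z z w k := rfl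
  rw [h2]
  ring

/-- At `z` the current is defined through the chart at `z`. Expressing it at all nearby points in
one fixed chart makes it possible to differentiate it. -/
theorem chartD_maxwellCurrent {F : DiffForm (𝓡 n) M 2} (hF : F.IsSmooth) {z : M}
    (hz : z ∈ (extChartAt (𝓡 n) x₀).source) :
    chartD (𝓡 n) x₀ z (g.maxwellCurrent F z) = g.codiffVec F x₀ (extChartAt (𝓡 n) x₀ z) := by
  have hzz := mem_extChartAt_source (I := 𝓡 n) z
  refine g.chartD_eq_codiffVec hF hzz hz ?_
  rw [← sub_eq_zero]
  apply g.metricCoord_nondegenerate ((extChartAt (𝓡 n) z).map_source hzz)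
  intro w
  obtain ⟨w, rfl⟩ := chartD_surjective hzz w
  rw [map_sub, sub_apply, ← g.val_eq_metricCoord hzz, ← codiff_apply, maxwellCurrent, val_sharp,
    sub_self]

theorem vecCoord_maxwellCurrent {F : DiffForm (𝓡 n) M 2} (hF : F.IsSmooth)
    (hy : y ∈ (extChartAt (𝓡 n) x₀).target) :
    vecCoord (g.maxwellCurrent F) x₀ y = g.codiffVec F x₀ y := by
  rw [vecCoord_def, g.chartD_maxwellCurrent hF ((extChartAt (𝓡 n) x₀).map_target hy),
    (extChartAt (𝓡 n) x₀).right_inv hy]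

theorem contMDiff_maxwellCurrent {F : DiffForm (𝓡 n) M 2} (hF : F.IsSmooth) :
    ContMDiff (𝓡 n) (𝓡 n).tangent ∞ (sectionMap (g.maxwellCurrent F)) := by
  intro z
  have hz := mem_extChartAt_source (I := 𝓡 n) z
  rw [contMDiffAt_sectionMap_iff hz]
  have hy := extChartAt_target_mem_nhds_of_mem ((extChartAt (𝓡 n) z).map_source hz)
  refine ((g.contDiffOn_codiffVec hF z).contDiffAt hy).congr_of_eventuallyEq ?_
  filter_upwards [hy] with w hw
  exact g.vecCoord_maxwellCurrent hF hw

/-- The Maxwell current is conserved. -/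
theorem divergence_maxwellCurrent {F : DiffForm (𝓡 n) M 2} (hF : F.IsSmooth) (x : M) :
    g.divergence (g.maxwellCurrent F) x = 0 := by
  set y := extChartAt (𝓡 n) x x
  have hy : y ∈ (extChartAt (𝓡 n) x).target := mem_extChartAt_target x
  let P : Fin n → Fin n → 𝔼 → ℝ := fun i j w ↦ g.density x w * g.raised F x w i j
  have hP (i j : Fin n) : ContDiffAt ℝ ∞ (P i j) y :=
    (g.contDiffOn_density_mul_raised hF x i j).contDiffAt (extChartAt_target_mem_nhds_of_mem hy)
  have hdP (i j : Fin n) : DifferentiableAt ℝ (fderiv ℝ (P i j)) y :=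
    ((g.contDiffOn_fderiv_density_mul_raised hF x i j).contDiffAt
      (extChartAt_target_mem_nhds_of_mem hy)).differentiableAt (by simp)
  have hdPe (i j : Fin n) :
      DifferentiableAt ℝ (fun w ↦ fderiv ℝ (P i j) w (EuclideanSpace.single i 1)) y :=
    (hdP i j).clm_apply (differentiableAt_const _)
  have hPanti (i j : Fin n) : P i j = -P j i := by
    funext w
    have := congrFun (congrFun (g.raised_transpose F x w) j) i
    simp only [Matrix.transpose_apply, Matrix.neg_apply] at this
    simp only [P, Pi.neg_apply, this]
    ring
  -- `c i j = ∂ⱼ∂ᵢ(√|g| Fⁱʲ)` is antisymmetric, and up to sign and the density `div J` is the sum of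
  -- all its entries.
  let c : Fin n → Fin n → ℝ := fun i j ↦
    fderiv ℝ (fderiv ℝ (P i j)) y (EuclideanSpace.single j 1) (EuclideanSpace.single i 1)
  have hc (i j : Fin n) : c i j = -c j i := by
    have hsymm : IsSymmSndFDerivAt ℝ (P j i) y :=
      (hP j i).isSymmSndFDerivAt (by simpa using ENat.LEInfty.out)
    have h1 : fderiv ℝ (-P j i) = -fderiv ℝ (P j i) := funext fun w ↦ fderiv_neg
    simp only [c]
    rw [hPanti i j, h1, fderiv_neg, hsymm]
    rfl
  have hj (j : Fin n) : fderiv ℝ (fun w ↦ g.density x w * vecCoord (g.maxwellCurrent F) x w j) y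
      (EuclideanSpace.single j 1) = -∑ i, c i j := by
    have hev : (fun w ↦ g.density x w * vecCoord (g.maxwellCurrent F) x w j) =ᶠ[𝓝 y]
        fun w ↦ -∑ i, fderiv ℝ (P i j) w (EuclideanSpace.single i 1) := by
      filter_upwards [extChartAt_target_mem_nhds_of_mem hy] with w hw
      rw [g.vecCoord_maxwellCurrent hF hw]
      have := g.density_ne_zero hw
      simp only [codiffVec, P]
      field_simp
    rw [hev.fderiv_eq, fderiv_fun_neg, neg_apply, fderiv_fun_sum fun i _ ↦ hdPe i j,
      _root_.sum_apply]
    congr 1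
    refine Finset.sum_congr rfl fun i _ ↦ ?_
    rw [fderiv_clm_apply (hdP i j) (differentiableAt_const _)]
    simp [c]
  have h0 := Finset.sum_sum_mul_eq_zero_of_symm_of_antisymm (a := fun _ _ ↦ (1 : ℝ))
    (fun _ _ ↦ rfl) hc
  simp only [one_mul] at h0
  unfold divergence
  rw [Finset.sum_congr rfl fun j _ ↦ hj j, Finset.sum_neg_distrib, Finset.sum_comm, h0, neg_zero,
    mul_zero]

end PseudoRiemMetric

/-! ### Functions with zero differential on a connected manifold -/

section LocallyConstant

variable {E : Type*} [NormedAddCommGroup E] [NormedSpace ℝ E]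
  {H : Type*} [TopologicalSpace H] {I : ModelWithCorners ℝ E H} [I.Boundaryless]
  {N : Type*} [TopologicalSpace N] [ChartedSpace H N] [IsManifold I ∞ N]

theorem eq_of_mfderiv_eq_zero [PreconnectedSpace N] {f : N → ℝ} (hf : MDifferentiable I 𝓘(ℝ, ℝ) f)
    (h : ∀ x, mfderiv I 𝓘(ℝ, ℝ) f x = 0) (x y : N) : f x = f y := by
  refine IsLocallyConstant.apply_eq_of_preconnectedSpace ?_ x y
  rw [IsLocallyConstant.iff_eventually_eq]
  intro z
  have hz := mem_extChartAt_source (I := I) z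
  obtain ⟨r, hr, hball⟩ := Metric.isOpen_iff.1 (isOpen_extChartAt_target (I := I) z) _
    ((extChartAt I z).map_source hz)
  have hd (w : E) (hw : w ∈ Metric.ball (extChartAt I z z) r) :
      HasFDerivAt (fun w ↦ f ((extChartAt I z).symm w)) (0 : E →L[ℝ] ℝ) w := by
    have h1 := (hf ((extChartAt I z).symm w)).hasMFDerivAt
    rw [h] at h1
    have h2 := (h1.comp w (hasMFDerivAt_extChartAt_symm (hball hw))).hasFDerivAt
    exact h2.congr_fderiv (ContinuousLinearMap.zero_comp _)
  have hev := eventually_extChartAt hz (Metric.ball_mem_nhds _ hr)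
  filter_upwards [hev, (isOpen_extChartAt_source (I := I) z).mem_nhds hz] with w hw hws
  have := (convex_ball _ r).is_const_of_fderivWithin_eq_zero (𝕜 := ℝ)
    (f := fun w ↦ f ((extChartAt I z).symm w)) (s := Metric.ball (extChartAt I z z) r)
    (fun w hw ↦ (hd w hw).differentiableAt.differentiableWithinAt)
    (fun w hw ↦ by rw [fderivWithin_of_isOpen Metric.isOpen_ball hw, (hd w hw).fderiv])
    hw (Metric.mem_ball_self hr)
  simpa only [(extChartAt I z).left_inv hz, (extChartAt I z).left_inv hws] using this

end LocallyConstant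

/-! ### The Liouville form, Lagrangian sections and the kinetic energy -/

section OneForms

variable {E : Type*} [NormedAddCommGroup E] [NormedSpace ℝ E]

theorem differentiableAt_comp_fst {W : Type*} [NormedAddCommGroup W] [NormedSpace ℝ W] {G : E → W}
    {ξ : E × E} (hG : DifferentiableAt ℝ G ξ.1) :
    DifferentiableAt ℝ (fun ξ : E × E ↦ G ξ.1) ξ :=
  hG.comp ξ differentiableAt_fst

theorem differentiableAt_ofSubsingleton_comp_fst {G : E → E →L[ℝ] E →L[ℝ] ℝ} {ξ : E × E}
    (hG : DifferentiableAt ℝ G ξ.1) :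
    DifferentiableAt ℝ (fun ξ : E × E ↦ ContinuousAlternatingMap.ofSubsingleton ℝ (E × E) ℝ
      (0 : Fin 1) ((G ξ.1 ξ.2).comp (ContinuousLinearMap.fst ℝ E E))) ξ := by
  have h1 : DifferentiableAt ℝ (fun ξ : E × E ↦ G ξ.1) ξ :=
    differentiableAt_comp_fst (W := E →L[ℝ] E →L[ℝ] ℝ) (G := G) hG
  have h2 : DifferentiableAt ℝ (fun ξ : E × E ↦ G ξ.1 ξ.2) ξ := h1.clm_apply differentiableAt_snd
  have h : DifferentiableAt ℝ (fun ξ : E × E ↦ (G ξ.1 ξ.2).comp (ContinuousLinearMap.fst ℝ E E))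
      ξ := h2.clm_comp (differentiableAt_const _)
  exact (ContinuousAlternatingMap.ofSubsingletonLIE (E := E × E) (F := ℝ) (𝕜 := ℝ)
    (0 : Fin 1)).differentiableAt.comp ξ h

end OneForms

namespace PseudoRiemMetric

open scoped Topology

variable {n : ℕ} {M : Type*} [TopologicalSpace M] [ChartedSpace (EuclideanSpace ℝ (Fin n)) M]
  [IsManifold (𝓡 n) ∞ M] (g : PseudoRiemMetric n M)

local notation "𝔼" => EuclideanSpace ℝ (Fin n)

theorem contMDiff_proj : ContMDiff (𝓡 n).tangent (𝓡 n) ∞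
    (fun q : TangentBundle (𝓡 n) M ↦ q.proj) :=
  Bundle.contMDiff_proj (TangentSpace (𝓡 n) : M → Type _)

theorem dproj_dsection {u : (x : M) → TangentSpace (𝓡 n) x} {x : M}
    (hu : ContMDiffAt (𝓡 n) (𝓡 n).tangent ∞ (sectionMap u) x) (v : TangentSpace (𝓡 n) x) :
    dproj (sectionMap u x) (dsection u x v) = v := by
  have h1 := ((contMDiff_proj (n := n) (M := M)) (sectionMap u x)).mdifferentiableAt (by simp)
  have h2 := hu.mdifferentiableAt (by simp)
  have h := mfderiv_comp x h1 h2
  have hid : (fun q : TangentBundle (𝓡 n) M ↦ q.proj) ∘ sectionMap u = id := rfl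
  rw [hid, mfderiv_id] at h
  exact (DFunLike.congr_fun h v).symm

/-- The tautological property of the Liouville form: `π ∘ u = id` makes `dproj` undo `dsection`. -/
theorem pullback_liouville {u : (x : M) → TangentSpace (𝓡 n) x} {x : M}
    (hu : ContMDiffAt (𝓡 n) (𝓡 n).tangent ∞ (sectionMap u) x) :
    (DiffForm.pullback (sectionMap u) g.liouville : DiffForm (𝓡 n) M 1) x = g.flat u x := by
  ext v
  change g.val x (u x) (dproj (sectionMap u x) (dsection u x (v 0))) = g.val x (u x) (v 0)
  rw [dproj_dsection hu]

theorem extChartAt_tangent_apply (p q : TangentBundle (𝓡 n) M)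
    (hq : q.proj ∈ (extChartAt (𝓡 n) p.proj).source) :
    extChartAt (𝓡 n).tangent p q =
      (extChartAt (𝓡 n) p.proj q.proj, chartD (𝓡 n) p.proj q.proj q.snd) := by
  rw [← trivializationAt_apply_eq_chartD hq, FiberBundle.extChartAt]
  have : (trivializationAt 𝔼 (TangentSpace (𝓡 n) : M → Type _) p.proj q).1 = q.proj :=
    Trivialization.coe_fst _ (by rw [Trivialization.mem_source]; simpa using hq)
  simp [this]

theorem mem_extChartAt_tangent_source (p q : TangentBundle (𝓡 n) M) :
    q ∈ (extChartAt (𝓡 n).tangent p).source ↔ q.proj ∈ (extChartAt (𝓡 n) p.proj).source := by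
  rw [FiberBundle.extChartAt]
  simp

/-- In the coordinates `(ξ₁, ξ₂)` of the tangent bundle, position and velocity, the Liouville form
is `g_{ξ₁}(ξ₂, dξ₁)`, with smooth coefficients. -/
theorem differentiableAt_liouville_inChart (p : TangentBundle (𝓡 n) M) :
    DifferentiableAt ℝ (g.liouville.inChart p) (extChartAt (𝓡 n).tangent p p) := by
  let x := p.proj
  have hξ₀ : extChartAt (𝓡 n).tangent p p ∈ (extChartAt (𝓡 n).tangent p).target :=
    mem_extChartAt_target p
  have hfst : (extChartAt (𝓡 n).tangent p p).1 = extChartAt (𝓡 n) x x := by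
    rw [extChartAt_tangent_apply p p (mem_extChartAt_source _)]
  have hθ : DifferentiableAt ℝ (fun ξ : 𝔼 × 𝔼 ↦ ContinuousAlternatingMap.ofSubsingleton ℝ
      (𝔼 × 𝔼) ℝ (0 : Fin 1) ((g.metricCoord x ξ.1 ξ.2).comp (ContinuousLinearMap.fst ℝ 𝔼 𝔼)))
      (extChartAt (𝓡 n).tangent p p) := by
    have hG : DifferentiableAt ℝ (g.metricCoord x) (extChartAt (𝓡 n).tangent p p).1 := by
      rw [hfst]
      exact ((g.contDiffOn_metricCoord x).contDiffAt (extChartAt_target_mem_nhds_of_mem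
        (mem_extChartAt_target x))).differentiableAt (by simp)
    exact differentiableAt_ofSubsingleton_comp_fst hG
  refine hθ.congr_of_eventuallyEq ?_
  filter_upwards [extChartAt_target_mem_nhds_of_mem hξ₀] with ξ hξ
  have hq : ∀ ξ ∈ (extChartAt (𝓡 n).tangent p).target,
      ((extChartAt (𝓡 n).tangent p).symm ξ).proj ∈ (extChartAt (𝓡 n) x).source := fun ξ hξ ↦
    (mem_extChartAt_tangent_source p _).1 ((extChartAt (𝓡 n).tangent p).map_target hξ)
  have hΦ : ∀ ξ ∈ (extChartAt (𝓡 n).tangent p).target,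
      (extChartAt (𝓡 n) x ((extChartAt (𝓡 n).tangent p).symm ξ).proj,
        chartD (𝓡 n) x ((extChartAt (𝓡 n).tangent p).symm ξ).proj
          ((extChartAt (𝓡 n).tangent p).symm ξ).snd) = ξ := fun ξ hξ ↦ by
    rw [← extChartAt_tangent_apply p _ (hq ξ hξ), (extChartAt (𝓡 n).tangent p).right_inv hξ]
  have hproj := hasFDerivAt_chart_comp (I := (𝓡 n).tangent) (I' := 𝓡 n) (y₀ := x) hξ (hq ξ hξ)
    ((contMDiff_proj ((extChartAt (𝓡 n).tangent p).symm ξ)).mdifferentiableAt (by simp))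
  -- In these coordinates the bundle projection is the first projection, which identifies the
  -- coordinate expression of `dproj`.
  have hev : (fun ξ ↦ extChartAt (𝓡 n) x ((extChartAt (𝓡 n).tangent p).symm ξ).proj) =ᶠ[𝓝 ξ]
      Prod.fst := by
    filter_upwards [extChartAt_target_mem_nhds_of_mem hξ] with ξ' hξ'
    exact congrArg Prod.fst (hΦ ξ' hξ')
  have hD := hproj.unique (hasFDerivAt_fst.congr_of_eventuallyEq hev)
  ext v
  change g.val _ ((extChartAt (𝓡 n).tangent p).symm ξ).snd
    (dproj ((extChartAt (𝓡 n).tangent p).symm ξ) (chartDsymm (𝓡 n).tangent p ξ (v 0))) =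
    g.metricCoord x ξ.1 ξ.2 (v 0).1
  rw [g.val_eq_metricCoord (hq ξ hξ)]
  have h1 : chartD (𝓡 n) x _ (dproj ((extChartAt (𝓡 n).tangent p).symm ξ)
      (chartDsymm (𝓡 n).tangent p ξ (v 0))) = (v 0).1 := DFunLike.congr_fun hD (v 0)
  have h2 := congrArg Prod.fst (hΦ ξ hξ)
  have h3 := congrArg Prod.snd (hΦ ξ hξ)
  dsimp only at h2 h3
  rw [h1, h2, h3]

theorem d_flat_eq {u : (x : M) → TangentSpace (𝓡 n) x} {x : M}
    (hu : ContMDiff (𝓡 n) (𝓡 n).tangent ∞ (sectionMap u)) :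
    (g.flat u).d x = (g.liouville.d (sectionMap u x)).compContinuousLinearMap (dsection u x) := by
  have h := g.liouville.d_pullback (hu x) (g.differentiableAt_liouville_inChart (sectionMap u x))
  rw [DiffForm.d_congr (η' := g.flat u)
    (Filter.Eventually.of_forall fun w ↦ g.pullback_liouville (hu w))] at h
  exact h

/-- Pulled back by the section, `dθ` becomes `d(i_u g)`, and the lifted `F` becomes `F` again. -/
theorem d_flat_of_isLagrangian {F : DiffForm (𝓡 n) M 2} {u : (x : M) → TangentSpace (𝓡 n) x}
    (hu : ContMDiff (𝓡 n) (𝓡 n).tangent ∞ (sectionMap u)) (h : g.IsLagrangian F u) (x : M) :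
    (g.flat u).d x = -F x := by
  rw [g.d_flat_eq hu, eq_neg_iff_add_eq_zero, ← h x]
  ext v
  simp only [omegaF, ContinuousAlternatingMap.compContinuousLinearMap_apply,
    ContinuousAlternatingMap.add_apply, Function.comp_def]
  congr 2
  ext i
  exact (dproj_dsection (hu x) _).symm

theorem contMDiff_kinetic : ContMDiff (𝓡 n).tangent 𝓘(ℝ, ℝ) ∞ g.kinetic := by
  intro p
  have := g.contMDiffAt_val (b := fun q : TangentBundle (𝓡 n) M ↦ q.proj) (v := fun q ↦ q.snd)
    (w := fun q ↦ q.snd) (contMDiff_proj p) contMDiffAt_id contMDiffAt_id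
  exact this.div_const 2

theorem val_eq_of_isIntermediateIntegral [PreconnectedSpace M] {F : DiffForm (𝓡 n) M 2}
    {D : (p : TangentBundle (𝓡 n) M) → TangentSpace (𝓡 n).tangent p} (hD : g.IsLorentzField F D)
    {u : (x : M) → TangentSpace (𝓡 n) x} (hu : ContMDiff (𝓡 n) (𝓡 n).tangent ∞ (sectionMap u))
    (hint : IsIntermediateIntegral D u) (hlag : g.IsLagrangian F u) (x y : M) :
    g.val x (u x) (u x) = g.val y (u y) (u y) := by
  have hk (p : TangentBundle (𝓡 n) M) : MDifferentiableAt (𝓡 n).tangent 𝓘(ℝ, ℝ) g.kinetic p :=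
    (g.contMDiff_kinetic p).mdifferentiableAt (by simp)
  have hu' (x : M) : MDifferentiableAt (𝓡 n) (𝓡 n).tangent (sectionMap u) x :=
    (hu x).mdifferentiableAt (by simp)
  have h := eq_of_mfderiv_eq_zero (I := 𝓡 n) (f := g.kinetic ∘ sectionMap u)
    (fun x ↦ (hk _).comp x (hu' x)) (fun x ↦ ?_) x y
  · simp only [Function.comp_apply, kinetic, sectionMap] at h
    exact (div_left_inj' two_ne_zero).1 h
  · rw [mfderiv_comp x (hk _) (hu' x)]
    ext w
    -- Both arguments of `ω_F` in Newton's equation are now tangent to the section, where `ω_F`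
    -- vanishes. Only the differential of the kinetic energy remains.
    obtain ⟨w', hw'⟩ := hint x
    have h1 := hD.newton (sectionMap u x) (dsection u x w)
    have h2 : g.omegaF F (sectionMap u x) ![D (sectionMap u x), dsection u x w] = 0 := by
      rw [← hw']
      have := DFunLike.congr_fun (hlag x) ![w', w]
      refine Eq.trans (congrArg (g.omegaF F (sectionMap u x)) ?_) this
      ext1 i
      fin_cases i <;> rfl
    rw [h2, zero_add] at h1
    exact h1

end PseudoRiemMetric

/-! ### Closed one-forms, gradients and the Klein-Gordon equation -/

section Closed

open scoped Topology

variable {E : Type*} [NormedAddCommGroup E] [NormedSpace ℝ E]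

theorem differentiableAt_ofSubsingleton {α : E → E →L[ℝ] ℝ} {y : E} (hα : DifferentiableAt ℝ α y) :
    DifferentiableAt ℝ
      (fun y ↦ ContinuousAlternatingMap.ofSubsingleton ℝ E ℝ (0 : Fin 1) (α y)) y :=
  (ContinuousAlternatingMap.ofSubsingletonLIE (E := E) (F := ℝ) (𝕜 := ℝ)
    (0 : Fin 1)).differentiableAt.comp y hα

theorem extDeriv_ofSubsingleton_apply {α : E → E →L[ℝ] ℝ} {y : E} (hα : DifferentiableAt ℝ α y)
    (v w : E) :
    extDeriv (fun y ↦ ContinuousAlternatingMap.ofSubsingleton ℝ E ℝ (0 : Fin 1) (α y)) y ![v, w] =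
      fderiv ℝ α y v w - fderiv ℝ α y w v := by
  have h (v w : E) : fderiv ℝ (fun y ↦ α y w) y v = fderiv ℝ α y v w := by
    rw [fderiv_clm_apply hα (differentiableAt_const _)]
    simp
  rw [extDeriv_apply (differentiableAt_ofSubsingleton hα), Fin.sum_univ_two]
  simp only [ContinuousAlternatingMap.ofSubsingleton_apply_apply]
  simp [Fin.removeNth, Fin.succAbove, h]
  ring

end Closed

namespace PseudoRiemMetric

open scoped Topology

variable {n : ℕ} {M : Type*} [TopologicalSpace M] [ChartedSpace (EuclideanSpace ℝ (Fin n)) M]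
  [IsManifold (𝓡 n) ∞ M] (g : PseudoRiemMetric n M)

local notation "𝔼" => EuclideanSpace ℝ (Fin n)

theorem sharp_eq {x : M} {α : TangentSpace (𝓡 n) x →L[ℝ] ℝ} {v : TangentSpace (𝓡 n) x}
    (h : g.val x v = α) : g.sharp x α = v := by
  rw [← sub_eq_zero]
  apply g.nondegenerate
  intro w
  rw [map_sub, val_sharp, h, sub_self]
  rfl

/-! ### The one-form of a vector field -/

variable {x₀ : M} {y : EuclideanSpace ℝ (Fin n)} {u v : (x : M) → TangentSpace (𝓡 n) x}

theorem flat_inChart (u : (x : M) → TangentSpace (𝓡 n) x)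
    (hy : y ∈ (extChartAt (𝓡 n) x₀).target) :
    (g.flat u).inChart x₀ y = ContinuousAlternatingMap.ofSubsingleton ℝ 𝔼 ℝ (0 : Fin 1)
      (g.metricCoord x₀ y (vecCoord u x₀ y)) := by
  ext w
  change g.val _ (u _) (chartDsymm (𝓡 n) x₀ y (w 0)) = g.metricCoord x₀ y (vecCoord u x₀ y) (w 0)
  rw [metricCoord_apply, vecCoord_def, chartDsymm_chartD hy]

theorem contDiffAt_metricCoord_vecCoord (hy : y ∈ (extChartAt (𝓡 n) x₀).target)
    (hu : ContMDiffAt (𝓡 n) (𝓡 n).tangent ∞ (sectionMap u) ((extChartAt (𝓡 n) x₀).symm y)) :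
    ContDiffAt ℝ ∞ (fun y ↦ g.metricCoord x₀ y (vecCoord u x₀ y)) y := by
  rw [contMDiffAt_sectionMap_iff ((extChartAt (𝓡 n) x₀).map_target hy),
    (extChartAt (𝓡 n) x₀).right_inv hy] at hu
  exact ((g.contDiffOn_metricCoord x₀).contDiffAt
    (extChartAt_target_mem_nhds_of_mem hy)).clm_apply hu

theorem flat_inChart_eventuallyEq (u : (x : M) → TangentSpace (𝓡 n) x)
    (hy : y ∈ (extChartAt (𝓡 n) x₀).target) :
    (g.flat u).inChart x₀ =ᶠ[𝓝 y] fun y ↦ ContinuousAlternatingMap.ofSubsingleton ℝ 𝔼 ℝ (0 : Fin 1)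
      (g.metricCoord x₀ y (vecCoord u x₀ y)) := by
  filter_upwards [extChartAt_target_mem_nhds_of_mem hy] with w hw
  exact g.flat_inChart u hw

theorem differentiableAt_flat_inChart (hy : y ∈ (extChartAt (𝓡 n) x₀).target)
    (hu : ContMDiffAt (𝓡 n) (𝓡 n).tangent ∞ (sectionMap u) ((extChartAt (𝓡 n) x₀).symm y)) :
    DifferentiableAt ℝ ((g.flat u).inChart x₀) y :=
  (differentiableAt_ofSubsingleton ((g.contDiffAt_metricCoord_vecCoord hy hu).differentiableAt
    (by simp))).congr_of_eventuallyEq (g.flat_inChart_eventuallyEq u hy)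

theorem d_flat_neg (u : (x : M) → TangentSpace (𝓡 n) x) (x : M) :
    (g.flat fun x ↦ -u x).d x = -(g.flat u).d x := by
  have h : (g.flat fun x ↦ -u x).inChart x = (-1 : ℝ) • (g.flat u).inChart x := by
    funext y
    ext w
    change g.val _ (-u _) _ = (-1 : ℝ) • g.val _ (u _) _
    rw [map_neg, neg_smul, one_smul]
    rfl
  rw [DiffForm.d_apply, DiffForm.d_apply, h, extDeriv_smul]
  ext w
  simp

theorem d_flat_add {x : M} (hu : ContMDiffAt (𝓡 n) (𝓡 n).tangent ∞ (sectionMap u) x)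
    (hv : ContMDiffAt (𝓡 n) (𝓡 n).tangent ∞ (sectionMap v) x) :
    (g.flat fun x ↦ u x + v x).d x = (g.flat u).d x + (g.flat v).d x := by
  have h : (g.flat fun x ↦ u x + v x).inChart x = (g.flat u).inChart x + (g.flat v).inChart x := by
    funext y
    ext w
    change g.val _ (u _ + v _) _ = g.val _ (u _) _ + g.val _ (v _) _
    rw [map_add]
    rfl
  have hx := mem_extChartAt_target (I := 𝓡 n) x
  have hinv := extChartAt_to_inv (I := 𝓡 n) x
  rw [DiffForm.d_apply, DiffForm.d_apply, DiffForm.d_apply, h,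
    extDeriv_add (g.differentiableAt_flat_inChart hx (by rwa [hinv]))
      (g.differentiableAt_flat_inChart hx (by rwa [hinv]))]
  rfl

theorem contMDiffAt_sectionMap_add {x : M}
    (hu : ContMDiffAt (𝓡 n) (𝓡 n).tangent ∞ (sectionMap u) x)
    (hv : ContMDiffAt (𝓡 n) (𝓡 n).tangent ∞ (sectionMap v) x) :
    ContMDiffAt (𝓡 n) (𝓡 n).tangent ∞ (sectionMap fun x ↦ u x + v x) x := by
  have hx := mem_extChartAt_source (I := 𝓡 n) x
  rw [contMDiffAt_sectionMap_iff hx] at *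
  refine (hu.add hv).congr_of_eventuallyEq (Filter.Eventually.of_forall fun y ↦ ?_)
  exact map_add (chartD (𝓡 n) x _) _ _

theorem contMDiffAt_sectionMap_neg {x : M}
    (hu : ContMDiffAt (𝓡 n) (𝓡 n).tangent ∞ (sectionMap u) x) :
    ContMDiffAt (𝓡 n) (𝓡 n).tangent ∞ (sectionMap fun x ↦ -u x) x := by
  have hx := mem_extChartAt_source (I := 𝓡 n) x
  rw [contMDiffAt_sectionMap_iff hx] at *
  refine hu.neg.congr_of_eventuallyEq (Filter.Eventually.of_forall fun y ↦ ?_)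
  exact map_neg (chartD (𝓡 n) x _) _

/-- A vector field whose one-form is closed is locally a gradient. -/
theorem exists_grad_eq {U : Set M} (hU : IsOpen U)
    (hu : ∀ x ∈ U, ContMDiffAt (𝓡 n) (𝓡 n).tangent ∞ (sectionMap u) x)
    (hd : ∀ x ∈ U, (g.flat u).d x = 0) {x : M} (hx : x ∈ U) :
    ∃ V : Set M, IsOpen V ∧ x ∈ V ∧ V ⊆ U ∧ ∃ S : M → ℝ,
      ContMDiffOn (𝓡 n) 𝓘(ℝ, ℝ) ∞ S V ∧ ∀ y ∈ V, u y = g.grad S y := by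
  have hxs := mem_extChartAt_source (I := 𝓡 n) x
  have hmem : (extChartAt (𝓡 n) x).target ∩ (extChartAt (𝓡 n) x).symm ⁻¹' U ∈
      𝓝 (extChartAt (𝓡 n) x x) :=
    Filter.inter_mem (extChartAt_target_mem_nhds x)
      (eventually_extChartAt_symm hxs (hU.mem_nhds hx))
  obtain ⟨r, hr, hball⟩ := Metric.mem_nhds_iff.1 hmem
  let α : 𝔼 → 𝔼 →L[ℝ] ℝ := fun y ↦ g.metricCoord x y (vecCoord u x y)
  have hα (y : 𝔼) (hy : y ∈ Metric.ball (extChartAt (𝓡 n) x x) r) : ContDiffAt ℝ ∞ α y :=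
    g.contDiffAt_metricCoord_vecCoord (hball hy).1 (hu _ (hball hy).2)
  -- Closedness of the 1-form is the symmetry of the derivative of `α`, the hypothesis of the
  -- Poincaré lemma on the ball. Each point `y` of the ball has its own preferred chart, so `d` is
  -- first moved to the chart at `x`.
  have hsymm (y : 𝔼) (hy : y ∈ Metric.ball (extChartAt (𝓡 n) x x) r) (v w : 𝔼) :
      fderiv ℝ α y v w = fderiv ℝ α y w v := by
    obtain ⟨hyt, hyU⟩ := hball hy
    have hys := (extChartAt (𝓡 n) x).map_target hyt
    have h1 := (g.flat u).d_eq_extDeriv (x₀ := x) hys (by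
      rw [(extChartAt (𝓡 n) x).right_inv hyt]
      exact g.differentiableAt_flat_inChart hyt (hu _ hyU))
    rw [hd _ hyU, (extChartAt (𝓡 n) x).right_inv hyt,
      (g.flat_inChart_eventuallyEq u hyt).extDeriv_eq] at h1
    obtain ⟨v, rfl⟩ := chartD_surjective hys v
    obtain ⟨w, rfl⟩ := chartD_surjective hys w
    have h2 := DFunLike.congr_fun h1 ![v, w]
    rw [← sub_eq_zero, ← extDeriv_ofSubsingleton_apply ((hα y hy).differentiableAt (by simp))]
    refine Eq.trans (congrArg _ ?_) h2.symm
    ext1 i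
    fin_cases i <;> rfl
  obtain ⟨s, hs⟩ := (convex_ball (extChartAt (𝓡 n) x x) r).exists_forall_hasFDerivAt_of_fderiv_symmetric
    Metric.isOpen_ball
    (fun y hy ↦ ((hα y hy).differentiableAt (by simp)).differentiableWithinAt) hsymm
  -- The primitive is smooth because its derivative is the smooth `α`.
  have hsd : ContDiffOn ℝ ∞ s (Metric.ball (extChartAt (𝓡 n) x x) r) := by
    refine (contDiffOn_infty_iff_fderiv_of_isOpen Metric.isOpen_ball).2
      ⟨fun y hy ↦ (hs y hy).differentiableAt.differentiableWithinAt, ?_⟩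
    exact ContDiffOn.congr (fun y hy ↦ (hα y hy).contDiffWithinAt) fun y hy ↦ (hs y hy).fderiv
  refine ⟨(extChartAt (𝓡 n) x).source ∩ extChartAt (𝓡 n) x ⁻¹'
    Metric.ball (extChartAt (𝓡 n) x x) r, ?_, ⟨hxs, Metric.mem_ball_self hr⟩, ?_,
    s ∘ extChartAt (𝓡 n) x, ?_, ?_⟩
  · exact (continuousOn_extChartAt x).isOpen_inter_preimage (isOpen_extChartAt_source x)
      Metric.isOpen_ball
  · rintro w ⟨hw, hwb⟩
    have := (hball hwb).2
    rwa [mem_preimage, (extChartAt (𝓡 n) x).left_inv hw] at this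
  · rintro w ⟨hw, hwb⟩
    exact (((hsd.contDiffAt (Metric.isOpen_ball.mem_nhds hwb)).contMDiffAt).comp w
      (contMDiffAt_extChartAt' (by simpa using hw))).contMDiffWithinAt
  · rintro w ⟨hw, hwb⟩
    refine (g.sharp_eq ?_).symm
    have h1 := (hs _ hwb).hasMFDerivAt.comp w
      (mdifferentiableAt_extChartAt (I := 𝓡 n) (x := x) (by simpa using hw)).hasMFDerivAt
    rw [h1.mfderiv]
    ext v
    rw [g.val_eq_metricCoord hw, ← vecCoord_extChartAt u hw]
    rfl

/-! ### Divergence and Laplacian -/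

theorem divergence_congr {x : M} (h : ∀ᶠ w in 𝓝 x, u w = v w) :
    g.divergence u x = g.divergence v x := by
  have hv : ∀ᶠ y in 𝓝 (extChartAt (𝓡 n) x x), vecCoord u x y = vecCoord v x y := by
    filter_upwards [eventually_extChartAt_symm (mem_extChartAt_source (I := 𝓡 n) x) h] with y hy
    rw [vecCoord_def, vecCoord_def, hy]
  unfold divergence
  congr 1
  refine Finset.sum_congr rfl fun i _ ↦ ?_
  rw [Filter.EventuallyEq.fderiv_eq]
  filter_upwards [hv] with y hy
  rw [hy]

theorem differentiableAt_density_mul_vecCoord {x : M}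
    (hu : ContMDiffAt (𝓡 n) (𝓡 n).tangent ∞ (sectionMap u) x) (i : Fin n) :
    DifferentiableAt ℝ (fun y ↦ g.density x y * vecCoord u x y i) (extChartAt (𝓡 n) x x) := by
  rw [contMDiffAt_sectionMap_iff (mem_extChartAt_source (I := 𝓡 n) x)] at hu
  exact (((g.contDiffOn_density x).contDiffAt (extChartAt_target_mem_nhds x)).differentiableAt
    (by simp)).mul ((EuclideanSpace.proj i : 𝔼 →L[ℝ] ℝ).differentiableAt.comp _
      (hu.differentiableAt (by simp)))

theorem divergence_add {x : M} (hu : ContMDiffAt (𝓡 n) (𝓡 n).tangent ∞ (sectionMap u) x)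
    (hv : ContMDiffAt (𝓡 n) (𝓡 n).tangent ∞ (sectionMap v) x) :
    g.divergence (fun x ↦ u x + v x) x = g.divergence u x + g.divergence v x := by
  unfold divergence
  rw [← mul_add, ← Finset.sum_add_distrib]
  congr 1
  refine Finset.sum_congr rfl fun i _ ↦ ?_
  rw [← add_apply, ← fderiv_fun_add (g.differentiableAt_density_mul_vecCoord hu i)
    (g.differentiableAt_density_mul_vecCoord hv i)]
  congr 2
  funext y
  rw [← mul_add]
  congr 1
  exact congrArg (fun w : 𝔼 ↦ w i) (map_add (chartD (𝓡 n) x _) _ _)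

theorem divergence_smul {x : M} (hu : ContMDiffAt (𝓡 n) (𝓡 n).tangent ∞ (sectionMap u) x)
    {f : M → ℝ} {f' : TangentSpace (𝓡 n) x →L[ℝ] ℝ} (hf : HasMFDerivAt (𝓡 n) 𝓘(ℝ, ℝ) f x f') :
    g.divergence (fun x ↦ f x • u x) x = f x * g.divergence u x + f' (u x) := by
  have hy := mem_extChartAt_target (I := 𝓡 n) x
  have hinv := extChartAt_to_inv (I := 𝓡 n) x
  have hf₁ : MDifferentiableAt (𝓡 n) 𝓘(ℝ, ℝ) f
      ((extChartAt (𝓡 n) x).symm (extChartAt (𝓡 n) x x)) := by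
    rw [hinv]
    exact hf.mdifferentiableAt
  let df : 𝔼 →L[ℝ] ℝ := (mfderiv (𝓡 n) 𝓘(ℝ, ℝ) f ((extChartAt (𝓡 n) x).symm
    (extChartAt (𝓡 n) x x))).comp (chartDsymm (𝓡 n) x (extChartAt (𝓡 n) x x))
  have hf' : HasFDerivAt (fun y ↦ f ((extChartAt (𝓡 n) x).symm y)) df (extChartAt (𝓡 n) x x) :=
    (hf₁.hasMFDerivAt.comp _ (hasMFDerivAt_extChartAt_symm hy)).hasFDerivAt
  have hD : fderiv ℝ (fun y ↦ f ((extChartAt (𝓡 n) x).symm y)) (extChartAt (𝓡 n) x x)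
      (vecCoord u x (extChartAt (𝓡 n) x x)) = f' (u x) := by
    -- The tangent spaces at `x` and at the inverse chart's value, equal to `x` only
    -- propositionally, are different types. The scalar function `D` carries the equality of points
    -- across.
    let D : M → ℝ := fun z ↦ mfderiv (𝓡 n) 𝓘(ℝ, ℝ) f z (u z)
    have h1 : D x = f' (u x) := DFunLike.congr_fun hf.mfderiv (u x)
    rw [← h1, ← congrArg D hinv]
    refine (DFunLike.congr_fun hf'.fderiv _).trans ?_
    exact congrArg (fun w ↦ (mfderiv (𝓡 n) 𝓘(ℝ, ℝ) f ((extChartAt (𝓡 n) x).symm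
      (extChartAt (𝓡 n) x x)) w : ℝ)) (chartDsymm_chartD hy (u _))
  have hi (i : Fin n) : fderiv ℝ (fun y ↦ g.density x y * vecCoord (fun x ↦ f x • u x) x y i)
      (extChartAt (𝓡 n) x x) (EuclideanSpace.single i 1) =
      f x * fderiv ℝ (fun y ↦ g.density x y * vecCoord u x y i) (extChartAt (𝓡 n) x x)
        (EuclideanSpace.single i 1) + g.density x (extChartAt (𝓡 n) x x) *
        (vecCoord u x (extChartAt (𝓡 n) x x) i *
          fderiv ℝ (fun y ↦ f ((extChartAt (𝓡 n) x).symm y)) (extChartAt (𝓡 n) x x)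
            (EuclideanSpace.single i 1)) := by
    have h1 : (fun y ↦ g.density x y * vecCoord (fun x ↦ f x • u x) x y i) =
        fun y ↦ f ((extChartAt (𝓡 n) x).symm y) * (g.density x y * vecCoord u x y i) := by
      funext y
      have : vecCoord (fun x ↦ f x • u x) x y = f ((extChartAt (𝓡 n) x).symm y) • vecCoord u x y :=
        map_smul (chartD (𝓡 n) x _) _ _
      rw [this]
      simp only [PiLp.smul_apply, smul_eq_mul]
      ring
    rw [h1, fderiv_fun_mul (c := fun y ↦ f ((extChartAt (𝓡 n) x).symm y)) hf'.differentiableAt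
      (g.differentiableAt_density_mul_vecCoord hu i)]
    simp only [add_apply, smul_apply, smul_eq_mul, hinv]
    ring
  have hρ := g.density_ne_zero hy
  unfold divergence
  simp only [hi]
  rw [Finset.sum_add_distrib, ← Finset.mul_sum, ← Finset.mul_sum, mul_add, mul_left_comm,
    inv_mul_cancel_left₀ hρ, ← hD, EuclideanSpace.clm_apply_eq_sum _ (vecCoord u x _)]
  simp only [smul_eq_mul]

theorem val_apply_of_eq_grad {S : M → ℝ} {x : M} {w : TangentSpace (𝓡 n) x} (h : w = g.grad S x)
    (v : TangentSpace (𝓡 n) x) : g.val x w v = mfderiv (𝓡 n) 𝓘(ℝ, ℝ) S x v := by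
  rw [h]
  exact DFunLike.congr_fun (g.val_sharp x _) v

/-- Here `grad h(S) = h'(S) u`, so the Leibniz rule gives `h''(S)‖u‖² + h'(S) div u`, and the last
term is zero. It is applied to `cos` and `sin`, the real and imaginary parts of the wave function.
-/
theorem laplacian_comp_of_grad_eq {U : Set M} (hU : IsOpen U)
    (hu : ∀ x ∈ U, ContMDiffAt (𝓡 n) (𝓡 n).tangent ∞ (sectionMap u) x) {S : M → ℝ}
    (hS : ∀ x ∈ U, MDifferentiableAt (𝓡 n) 𝓘(ℝ, ℝ) S x) (hgrad : ∀ x ∈ U, u x = g.grad S x)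
    {h h' h'' : ℝ → ℝ} (hh : ∀ t, HasDerivAt h (h' t) t) (hh' : ∀ t, HasDerivAt h' (h'' t) t)
    {x : M} (hx : x ∈ U) (hdiv : g.divergence u x = 0) :
    g.laplacian (fun y ↦ h (S y)) x = h'' (S x) * g.val x (u x) (u x) := by
  have hcomp {k k' : ℝ → ℝ} (hk : ∀ t, HasDerivAt k (k' t) t) {w : M} (hw : w ∈ U) :
      HasMFDerivAt (𝓡 n) 𝓘(ℝ, ℝ) (fun y ↦ k (S y)) w (k' (S w) • g.val w (u w)) := by
    have h1 := (hk (S w)).hasFDerivAt.hasMFDerivAt.comp w (hS w hw).hasMFDerivAt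
    refine h1.congr_mfderiv ?_
    ext v
    exact (mul_comm _ _).trans (congrArg (k' (S w) * ·)
      (val_apply_of_eq_grad g (hgrad w hw) v).symm)
  have hev : ∀ᶠ w in 𝓝 x, g.grad (fun y ↦ h (S y)) w = h' (S w) • u w := by
    filter_upwards [hU.mem_nhds hx] with w hw
    exact g.sharp_eq (by rw [map_smul, (hcomp hh hw).mfderiv])
  rw [laplacian, g.divergence_congr hev, g.divergence_smul (hu x hx)
    (f := fun y ↦ h' (S y)) (hcomp hh' hx), hdiv, mul_zero, zero_add]
  rfl

theorem kleinGordonAt_exp {U : Set M} (hU : IsOpen U)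
    {J A : (x : M) → TangentSpace (𝓡 n) x}
    (hJ : ∀ x ∈ U, ContMDiffAt (𝓡 n) (𝓡 n).tangent ∞ (sectionMap J) x)
    (hA : ∀ x ∈ U, ContMDiffAt (𝓡 n) (𝓡 n).tangent ∞ (sectionMap A) x) {S : M → ℝ}
    (hS : ∀ x ∈ U, MDifferentiableAt (𝓡 n) 𝓘(ℝ, ℝ) S x)
    (hgrad : ∀ x ∈ U, J x + A x = g.grad S x) {x : M} (hx : x ∈ U)
    (hdivJ : g.divergence J x = 0) (hdivA : g.divergence A x = 0) {m : ℂ}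
    (hm : (g.val x (J x) (J x) : ℂ) = m ^ 2) :
    g.KleinGordonAt A m (fun y ↦ Complex.exp (Complex.I * (S y : ℂ))) x := by
  have hdiv : g.divergence (fun x ↦ J x + A x) x = 0 := by
    rw [g.divergence_add (hJ x hx) (hA x hx), hdivJ, hdivA, add_zero]
  have hlap := fun {h h' h'' : ℝ → ℝ} (hh : ∀ t, HasDerivAt h (h' t) t)
      (hh' : ∀ t, HasDerivAt h' (h'' t) t) ↦
    g.laplacian_comp_of_grad_eq hU (fun x hx ↦ contMDiffAt_sectionMap_add (hJ x hx) (hA x hx)) hS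
      hgrad hh hh' hx hdiv
  have hcos := hlap Real.hasDerivAt_cos fun t ↦ (Real.hasDerivAt_sin t).neg
  have hsin := hlap Real.hasDerivAt_sin Real.hasDerivAt_cos
  have hexp (t : ℝ) : Complex.exp (Complex.I * t) = Real.cos t + Real.sin t * Complex.I := by
    rw [mul_comm, Complex.exp_mul_I, Complex.ofReal_cos, Complex.ofReal_sin]
  have hre : (fun y ↦ (Complex.exp (Complex.I * (S y : ℂ))).re) = fun y ↦ Real.cos (S y) := by
    funext y
    rw [mul_comm, Complex.exp_ofReal_mul_I_re]
  have him : (fun y ↦ (Complex.exp (Complex.I * (S y : ℂ))).im) = fun y ↦ Real.sin (S y) := by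
    funext y
    rw [mul_comm, Complex.exp_ofReal_mul_I_im]
  have hder : derivC A (fun y ↦ Complex.exp (Complex.I * (S y : ℂ))) x =
      (g.val x (J x + A x) (A x) : ℂ) *
        (Complex.exp (Complex.I * (S x : ℂ)) * Complex.I) := by
    have h1 : HasDerivAt (fun t : ℝ ↦ Complex.exp (Complex.I * (t : ℂ)))
        (Complex.exp (Complex.I * (S x : ℂ)) * Complex.I) (S x) := by
      have h2 := (Complex.ofRealCLM.hasDerivAt (x := S x)).const_mul Complex.I
      simpa using h2.cexp
    have h2 := h1.hasFDerivAt.hasMFDerivAt.comp x (hS x hx).hasMFDerivAt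
    rw [g.val_apply_of_eq_grad (hgrad x hx)]
    exact (DFunLike.congr_fun h2.mfderiv (A x)).trans Complex.real_smul
  rw [KleinGordonAt, laplacianC, hre, him, hcos, hsin, hder, ← hm]
  simp only [map_add, add_apply, g.symm x (A x) (J x), hexp]
  push_cast
  -- Only `i² = -1` remains to be used. Its coefficient `-2⟨J+A, A⟩ e^{iS}` comes from the term `-2i
  -- A(Ψ)`.
  linear_combination -2 * ((g.val x (J x) (A x) : ℂ) + g.val x (A x) (A x)) *
    (Complex.cos (S x) + Complex.I * Complex.sin (S x)) * Complex.I_sq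

end PseudoRiemMetric

end

/-! ### The main theorem -/

theorem mainTheorem10 {n : ℕ} {M : Type*} [TopologicalSpace M]
    [ChartedSpace (EuclideanSpace ℝ (Fin n)) M] [IsManifold (𝓡 n) ∞ M] [PreconnectedSpace M]
    (g : PseudoRiemMetric n M) (F : DiffForm (𝓡 n) M 2) (hF : F.IsSmooth) (hdF : F.d = 0)
    (D : (p : TangentBundle (𝓡 n) M) → TangentSpace (𝓡 n).tangent p)
    (hD : g.IsLorentzField F D)
    (hint : PseudoRiemMetric.IsIntermediateIntegral D (g.maxwellCurrent F))
    (hlag : g.IsLagrangian F (g.maxwellCurrent F)) :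
    g.IsVectorPotentialOn F (fun x ↦ -g.maxwellCurrent F x) univ ∧
    ∃ m : ℂ,
      (∀ x : M, (g.val x (g.maxwellCurrent F x) (g.maxwellCurrent F x) : ℂ) = m ^ 2) ∧
      ∀ (U : Set M) (A : (x : M) → TangentSpace (𝓡 n) x), IsOpen U →
        g.IsVectorPotentialOn F A U →
        (∀ x ∈ U, ∃ V : Set M, IsOpen V ∧ x ∈ V ∧ V ⊆ U ∧ ∃ S : M → ℝ,
          ContMDiffOn (𝓡 n) 𝓘(ℝ, ℝ) ∞ S V ∧
          ∀ y ∈ V, g.maxwellCurrent F y + A y = g.grad S y) ∧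
        ((∀ x ∈ U, g.divergence A x = 0) →
          ∀ S : M → ℝ, ContMDiffOn (𝓡 n) 𝓘(ℝ, ℝ) ∞ S U →
            (∀ x ∈ U, g.maxwellCurrent F x + A x = g.grad S x) →
            ∀ x ∈ U, g.KleinGordonAt A m (fun y ↦ Complex.exp (Complex.I * (S y : ℂ))) x) := by
  have hJ := g.contMDiff_maxwellCurrent hF
  have hdJ := g.d_flat_of_isLagrangian hJ hlag
  have hval := g.val_eq_of_isIntermediateIntegral hD hJ hint hlag
  refine ⟨⟨fun x _ ↦ (PseudoRiemMetric.contMDiffAt_sectionMap_neg (hJ x)).contMDiffWithinAt,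
    fun x _ ↦ by rw [g.d_flat_neg, hdJ, neg_neg]⟩, ?_⟩
  obtain ⟨m, hm⟩ : ∃ m : ℂ, ∀ x : M,
      (g.val x (g.maxwellCurrent F x) (g.maxwellCurrent F x) : ℂ) = m ^ 2 := by
    rcases isEmpty_or_nonempty M with hM | ⟨⟨x₀⟩⟩
    · exact ⟨0, fun x ↦ isEmptyElim x⟩
    · obtain ⟨m, hm⟩ := IsAlgClosed.exists_pow_nat_eq
        (g.val x₀ (g.maxwellCurrent F x₀) (g.maxwellCurrent F x₀) : ℂ) two_pos
      exact ⟨m, fun x ↦ by rw [hval x x₀, hm]⟩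
  refine ⟨m, hm, fun U A hU hA ↦ ?_⟩
  have hA' (x : M) (hx : x ∈ U) :
      ContMDiffAt (𝓡 n) (𝓡 n).tangent ∞ (PseudoRiemMetric.sectionMap A) x :=
    hA.1.contMDiffAt (hU.mem_nhds hx)
  refine ⟨fun x hx ↦ ?_, fun hdiv S hS hgrad x hx ↦ ?_⟩
  · refine g.exists_grad_eq (u := fun x ↦ g.maxwellCurrent F x + A x) hU
      (fun x hx ↦ PseudoRiemMetric.contMDiffAt_sectionMap_add (hJ x) (hA' x hx)) ?_ hx
    intro x hx
    rw [g.d_flat_add (hJ x) (hA' x hx), hdJ, hA.2 x hx, neg_add_cancel]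
  · exact g.kleinGordonAt_exp hU (fun x _ ↦ hJ x) hA'
      (fun x hx ↦ (hS.contMDiffAt (hU.mem_nhds hx)).mdifferentiableAt (by simp)) hgrad hx
      (g.divergence_maxwellCurrent hF x) (hdiv x hx) (hm x)
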